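/- Conventions. A finite hypergraph $H$ has a finite vertex set $V(H)$ and a set $E(H)$ of subsets of $V(H)$ as edges. $T(H)=\{|F|:F\in E(H)\}$ is its set of edge types, and $H$ is called a $T$-graph if $T(H)=T$. $H^r$ is the hypergraph on $V(H)$ formed by the edges of $H$ with exactly $r$ vertices. $K_t^{T}$ is the hypergraph on $t$ vertices whose edges are all sets of vertices with size in $T$. A complete $T$-subgraph of $H$ of order $s$ is a set $S\subseteq V(H)$ with $|S|=s$ such that every subset of $S$ with size in $T$ is an edge of $H$, where $s\ge k$ for every $k\in T$ (so that the subgraph has all edge types in $T$). The graph-Lagrangian is $$\lambda'(H)=\max\Big\{\sum_{r\in T(H)} r!\sum_{e\in E(H^r)}\prod_{i\in e}x_i \;:\; x_i\ge 0\ (i\in V(H)),\ \sum_{i\in V(H)}x_i=1\Big\}.$$ **Theorem.** Let $H$ be a finite hypergraph and let $m\ge 0$ and $t\ge 1$ be integers. (a) Let $r\ge 3$ and $\binom tr\le m\le \binom tr+\binom{t-1}{r-1}-(2^{r-3}-1)\left(\binom{t-1}{r-2}-1\right)$. Let $H$ be a $\{2,r\}$-graph (respectively a $\{1,2,r\}$-graph)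 on $t+1$ vertices with $m$ edges in $H^r$. If both the maximum order of a complete $\{2,r\}$-subgraph (resp. $\{1,2,r\}$-subgraph) of $H$ and the maximum order of a complete $\{2\}$-subgraph (resp. $\{1,2\}$-subgraph) of $H$ equal $t$, then $\lambda'(H)=\lambda'(K_t^{\{2,r\}})$ (resp. $\lambda'(H)=\lambda'(K_t^{\{1,2,r\}})$). (b) Let $\binom t3\le m\le\binom t3+\binom{t-1}2$. Let $H$ be a $\{2,3\}$-graph (respectively a $\{1,2,3\}$-graph), with any number of vertices, with $m$ edges in $H^3$. If both the maximum order of a complete $\{2,3\}$-subgraph (resp. $\{1,2,3\}$-subgraph) of $H$ and the maximum order of a complete $\{2\}$-subgraph (resp. $\{1,2\}$-subgraph) of $H$ equal $t$, then $\lambda'(H)=\lambda'(K_t^{\{2,3\}})$ (resp. $\lambda'(H)=\lambda'(K_t^{\{1,2,3\}})$). (c) Let $\binom t3\le m\le\binom t3+\binom{t-1}2-\frac t2$. Let $H$ be a $\{1,3\}$-graph with $m$ edges in $H^3$. If the maximum order of a complete $\{1,3\}$-subgraph of $H$ is $t$, then $\lambda'(H)=\lambda'(K_t^{\{1,3\}})$;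 otherwise (that is, if $H$ has no complete $\{1,3\}$-subgraph or their maximum order is not $t$) $\lambda'(H)<\lambda'(K_t^{\{1,3\}})$. In particular $\lambda'(H)<\lambda'(K_t^{\{1,3\}})$ whenever the maximum complete $\{3\}$-subgraph of $H$ is not $K_t^{\{3\}}$ (that is, $H$ has no complete $\{3\}$-subgraph or their maximum order is not $t$). -/

import Mathlib

namespace Hypergraph

/-- The set `T(H) = {|F| : F ∈ E(H)}` of edge types of `H`; `H` is a `T`-graph if
`H.edgeTypes = T`. -/
def edgeTypes {α : Type*} (H : Hypergraph α) : Set ℕ :=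
  Set.ncard '' H.edgeSet

/-- The level hypergraph `H^r`: same vertices, only the edges with exactly `r` vertices. -/
def level {α : Type*} (H : Hypergraph α) (r : ℕ) : Hypergraph α where
  vertexSet := H.vertexSet
  edgeSet := {e | e ∈ H.edgeSet ∧ e.ncard = r}
  subset_vertexSet_of_mem_edgeSet' := fun _ he => H.subset_vertexSet_of_mem_edgeSet' he.1

/-- The complete hypergraph `K_t^T` on `t` vertices: its edges are all vertex sets whose size is
in `T`. -/
def completeTypes (T : Set ℕ) (t : ℕ) : Hypergraph (Fin t) where
  vertexSet := Set.univ
  edgeSet := {e | e.ncard ∈ T}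
  subset_vertexSet_of_mem_edgeSet' := fun _ _ => Set.subset_univ _

/-- `S` is the vertex set of a complete `T`-subgraph of `H`: every subset of `S` whose size is in
`T` is an edge of `H`. A complete `T`-subgraph is itself a `T`-graph, so it has edges of every
type in `T`, that is, `k ≤ |S|` for all `k ∈ T`. -/
def IsCompleteSubgraph {α : Type*} (H : Hypergraph α) (T : Set ℕ) (S : Finset α) : Prop :=
  (S : Set α) ⊆ H.vertexSet ∧ (∀ k ∈ T, k ≤ S.card) ∧
    ∀ e : Finset α, e ⊆ S → e.card ∈ T → (e : Set α) ∈ H.edgeSet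

/-- The maximum complete `T`-subgraphs of `H` exist and have order (number of vertices) `t`. -/
def HasMaxCompleteOrder {α : Type*} (H : Hypergraph α) (T : Set ℕ) (t : ℕ) : Prop :=
  IsGreatest {n : ℕ | ∃ S : Finset α, H.IsCompleteSubgraph T S ∧ S.card = n} t

open Classical in
/-- The polynomial `λ'(H, x) = ∑_{r ∈ T(H)} r! ∑_{e ∈ E(H^r)} ∏_{i ∈ e} x_i`, written as one sum
over all edges of `H`. -/
noncomputable def lagrangianPoly {α : Type*} [Fintype α] (H : Hypergraph α) (x : α → ℝ) : ℝ :=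
  ∑ e ∈ Finset.univ.filter (fun e : Finset α => (e : Set α) ∈ H.edgeSet),
    (e.card.factorial : ℝ) * ∏ i ∈ e, x i

/-- The feasible weightings: nonnegative weights on the vertices of `H` with sum `1`
(points of the ambient type that are not vertices get weight `0`). -/
def feasibleWeightings {α : Type*} [Fintype α] (H : Hypergraph α) : Set (α → ℝ) :=
  {x | x ∈ stdSimplex ℝ α ∧ ∀ i, i ∉ H.vertexSet → x i = 0}

/-- The graph-Lagrangian `λ'(H)`, the maximum of `λ'(H, x)` over the feasible weightings. -/
noncomputable def lagrangian {α : Type*} [Fintype α] (H : Hypergraph α) : ℝ :=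
  sSup (H.lagrangianPoly '' H.feasibleWeightings)

/-- The supremum in the definition of `λ'(H)` is a maximum as soon as `H` has a vertex. -/
theorem isGreatest_lagrangian {α : Type*} [Fintype α] (H : Hypergraph α)
    (hH : H.vertexSet.Nonempty) :
    IsGreatest (H.lagrangianPoly '' H.feasibleWeightings) H.lagrangian := by
  classical
  have hc : IsCompact H.feasibleWeightings := by
    have h : IsClosed {x : α → ℝ | ∀ i, i ∉ H.vertexSet → x i = 0} := by
      simp only [Set.ofPred_forall]
      exact isClosed_iInter fun i => isClosed_iInter fun _ =>
        isClosed_eq (continuous_apply i) continuous_const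
    exact (isCompact_stdSimplex ℝ α).inter_right h
  have hp : Continuous H.lagrangianPoly := by
    unfold lagrangianPoly
    fun_prop
  obtain ⟨v, hv⟩ := hH
  have hne : H.feasibleWeightings.Nonempty := by
    refine ⟨Pi.single v 1, single_mem_stdSimplex ℝ v, fun i hi => ?_⟩
    have : i ≠ v := fun h => hi (h ▸ hv)
    simp [this]
  exact (hc.image hp).isGreatest_sSup (hne.image _)

end Hypergraph

/-!
The graph-Lagrangian of a hypergraph with edge types `T` is the maximum over weightings `x` of
`∑ r ∈ T, r! * weight E_r x`, where `E_r` is the family of its edges of size `r`, and a complete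
`T`-subgraph of order `t` with the uniform weighting already gives the value of the complete
hypergraph (`le_lagrangian`, `lagrangian_completeTypes`). The upper bound is proved for
the sizes one and two and for the size `r` separately, both parts being largest at that weighting:
the former is at most `2 - 1 / t` by the theorem of Motzkin and Straus (`motzkin_straus`), the
singletons alone weigh at most `1`, and what remains is to bound `weight E x` for an `r`-uniform family `E` by the
value `(t choose r) / t ^ r` of the complete `r`-graph on `t` vertices.

For `r = 3`, let `x` be an optimal weighting and `S` the set of its `t` largest weights. All links
of vertices in the support weigh `3 * weight E x` (`link_eq_of_isMax`), so it suffices to bound the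
sum of the links over `S`. This sum consists of the complete part on `S`, minus the triples missing
in `S`, plus the pairs of `S` in the links of the outer vertices, plus the edges with one vertex in
`S` (`sum_link_triples`). The number of edges forces an outer link to miss pairs of `S`, and
the degree sequence of the missing pairs enters a sum of squares, which yields the bound
(`quadratic_le`); edges with one vertex in `S` are charged to missing triples and to unused pairs
(`sum_link_le_of_light`). An outer vertex with too many pairs in its link forces many missing
triples, whose multiplicities complete the degree sequence (`sum_link_lt_of_heavy`). With `t / 2`
edges to spare, the bound is strict unless the support of `x` is a complete subgraph
(`complete_of_choose_three_le`). With a complete subgraph of order `t` given in advance,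
compressions move it to the largest weights, and the nonstrict bound needs no spare edges
(`weight_le_of_complete`).

For `r = k + 2 ≥ 4` there is one vertex `v` outside the complete subgraph `S`, and in some optimal
weighting it has the smallest weight. The first order condition between the largest and the
smallest weight of `S` shows that their ratio is at most two and bounds the part of the link of `v`
that contains the vertex `b` of smallest weight in `S` (`mul_link_le`). The number of edges
and a numerical estimate (`sub_le_of_choose`) then show that merging `v` into `b` does not decrease
the value, and Maclaurin's inequality on `S` finishes the proof (`weight_le_of_complete_insert`).
-/

namespace GraphLagrangian

open Finset

variable {α : Type*}

/-! ### Weight polynomials of families of sets -/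

/-- The homogeneous multilinear polynomial `∑_{e ∈ E} ∏_{i ∈ e} x_i` of a family `E` of finite
sets; the factorial weights of the graph-Lagrangian are left out. -/
noncomputable def weight (E : Finset (Finset α)) (x : α → ℝ) : ℝ :=
  ∑ e ∈ E, ∏ i ∈ e, x i

/-- The partial derivative of `weight E` with respect to `x i`, that is, the weight of the link
of `i` in `E`. -/
noncomputable def link [DecidableEq α] (E : Finset (Finset α)) (x : α → ℝ) (i : α) : ℝ :=
  ∑ e ∈ E with i ∈ e, ∏ j ∈ e.erase i, x j

/-- The mixed second partial derivative of `weight E` with respect to `x i` and `x j`. -/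
noncomputable def codeg [DecidableEq α] (E : Finset (Finset α)) (x : α → ℝ) (i j : α) : ℝ :=
  ∑ e ∈ E with i ∈ e ∧ j ∈ e, ∏ k ∈ (e.erase i).erase j, x k

/-- The probability weightings of `α` supported on `V`. -/
def weightings [Fintype α] (V : Set α) : Set (α → ℝ) :=
  {x | x ∈ stdSimplex ℝ α ∧ ∀ i, i ∉ V → x i = 0}

lemma weight_nonneg {E : Finset (Finset α)} {x : α → ℝ} (hx : ∀ i, 0 ≤ x i) : 0 ≤ weight E x :=
  sum_nonneg fun _ _ => prod_nonneg fun i _ => hx i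

lemma weight_mono {E F : Finset (Finset α)} {x : α → ℝ} (hx : ∀ i, 0 ≤ x i) (h : E ⊆ F) :
    weight E x ≤ weight F x :=
  sum_le_sum_of_subset_of_nonneg h fun _ _ _ => prod_nonneg fun i _ => hx i

lemma weight_powersetCard_const {S : Finset α} (r : ℕ) {x : α → ℝ} {c : ℝ}
    (hx : ∀ i ∈ S, x i = c) : weight (powersetCard r S) x = S.card.choose r * c ^ r := by
  unfold weight
  rw [sum_congr rfl (g := fun _ => c ^ r)]
  · simp
  · intro e he
    rw [mem_powersetCard] at he
    rw [prod_congr rfl fun i hi => hx i (he.1 hi), prod_const, he.2]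

lemma continuous_weight (E : Finset (Finset α)) : Continuous (weight E) := by
  unfold weight
  fun_prop

lemma isCompact_weightings [Fintype α] (V : Set α) : IsCompact (weightings V) := by
  have h : IsClosed {x : α → ℝ | ∀ i, i ∉ V → x i = 0} := by
    simp only [Set.ofPred_forall]
    exact isClosed_iInter fun i => isClosed_iInter fun _ =>
      isClosed_eq (continuous_apply i) continuous_const
  exact (isCompact_stdSimplex ℝ α).inter_right h

lemma sum_eq_one_of_mem_weightings [Fintype α] {S : Finset α} {x : α → ℝ}
    (hx : x ∈ weightings (S : Set α)) : ∑ i ∈ S, x i = 1 := by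
  rw [← hx.1.2]
  exact sum_subset (subset_univ S) fun i _ hi => hx.2 i (by simpa using hi)

/-! ### Exchanging weight between two vertices -/

section Basic

variable [DecidableEq α]

lemma codeg_nonneg {E : Finset (Finset α)} {x : α → ℝ} (hx : ∀ i, 0 ≤ x i) (i j : α) :
    0 ≤ codeg E x i j :=
  sum_nonneg fun _ _ => prod_nonneg fun i _ => hx i

/-- The weighting obtained from `x` by moving the amount `ε` from `j` to `i`. -/
def shift (x : α → ℝ) (i j : α) (ε : ℝ) : α → ℝ :=
  fun k => if k = i then x i + ε else if k = j then x j - ε else x k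

lemma prod_shift_of_notMem {e : Finset α} (x : α → ℝ) {i j : α} (ε : ℝ) (hi : i ∉ e)
    (hj : j ∉ e) : ∏ k ∈ e, shift x i j ε k = ∏ k ∈ e, x k := by
  refine prod_congr rfl fun k hk => ?_
  have h1 : k ≠ i := fun h => hi (h ▸ hk)
  have h2 : k ≠ j := fun h => hj (h ▸ hk)
  simp [shift, h1, h2]

/-- Second order expansion along an exchange direction; it is exact because every edge is
linear in each variable. -/
lemma weight_shift (E : Finset (Finset α)) (x : α → ℝ) {i j : α} (hij : i ≠ j) (ε : ℝ) :
    weight E (shift x i j ε) =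
      weight E x + ε * (link E x i - link E x j) - ε ^ 2 * codeg E x i j := by
  unfold weight link codeg
  rw [sum_filter, sum_filter, sum_filter, ← sum_sub_distrib, mul_sum, mul_sum,
    ← sum_add_distrib, ← sum_sub_distrib]
  refine sum_congr rfl fun e _ => ?_
  have si : shift x i j ε i = x i + ε := by simp [shift]
  have sj : shift x i j ε j = x j - ε := by simp [shift, hij.symm]
  by_cases hi : i ∈ e <;> by_cases hj : j ∈ e
  · have hj' : j ∈ e.erase i := mem_erase.2 ⟨hij.symm, hj⟩
    have hi' : i ∈ e.erase j := mem_erase.2 ⟨hij, hi⟩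
    rw [← mul_prod_erase e _ hi, ← mul_prod_erase (e.erase i) _ hj',
      ← mul_prod_erase e x hi, ← mul_prod_erase (e.erase i) x hj',
      ← mul_prod_erase (e.erase j) x hi', erase_right_comm (a := j) (b := i),
      prod_shift_of_notMem _ _ (by simp) (by simp), si, sj]
    simp only [hi, hj, if_true, and_self]
    ring
  · rw [← mul_prod_erase e _ hi, ← mul_prod_erase e x hi,
      prod_shift_of_notMem _ _ (by simp) (by simp [hj]), si]
    simp only [hi, hj, if_true, if_false, and_false]
    ring
  · rw [← mul_prod_erase e _ hj, ← mul_prod_erase e x hj,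
      prod_shift_of_notMem _ _ (by simp [hi]) (by simp), sj]
    simp only [hi, hj, if_true, if_false, false_and]
    ring
  · rw [prod_shift_of_notMem _ _ hi hj]
    simp [hi, hj]

/-- Euler's identity for an `r`-uniform family. -/
lemma sum_mul_link [Fintype α] {E : Finset (Finset α)} {r : ℕ} (hE : ∀ e ∈ E, e.card = r)
    (x : α → ℝ) : ∑ i, x i * link E x i = r * weight E x := by
  unfold link weight
  simp only [sum_filter, mul_sum]
  rw [sum_comm]
  refine sum_congr rfl fun e he => ?_
  have : ∀ i, x i * (if i ∈ e then ∏ j ∈ e.erase i, x j else 0)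
      = if i ∈ e then ∏ j ∈ e, x j else 0 := by
    intro i
    split_ifs with h
    · exact mul_prod_erase e x h
    · simp
  simp only [this]
  rw [← sum_filter, sum_const]
  simp [hE e he]

end Basic

/-! ### First order conditions at a maximizer -/

section Simplex

variable [Fintype α] [DecidableEq α]

lemma shift_mem_weightings {V : Set α} {x : α → ℝ} (hx : x ∈ weightings V) {i j : α}
    (hij : i ≠ j) (hi : i ∈ V) {ε : ℝ} (h0 : 0 ≤ ε) (h1 : ε ≤ x j) :
    shift x i j ε ∈ weightings V := by
  obtain ⟨⟨hpos, hsum⟩, hV⟩ := hx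
  refine ⟨⟨fun k => ?_, ?_⟩, fun k hk => ?_⟩
  · unfold shift
    split_ifs
    · linarith [hpos i]
    · linarith
    · exact hpos k
  · rw [← hsum]
    have : ∀ k, shift x i j ε k = x k + ((if k = i then ε else 0) - if k = j then ε else 0) := by
      intro k
      unfold shift
      split_ifs with h1 h2 h2
      · exact absurd (h1.symm.trans h2) hij
      · simp [h1]
      · simp [h2, sub_eq_add_neg]
      · simp
    simp only [this, sum_add_distrib, sum_sub_distrib]
    simp
  · unfold shift
    have hki : k ≠ i := fun h => hk (h ▸ hi)
    rw [if_neg hki]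
    split_ifs with h
    · have := hV k hk
      rw [← h, this] at h1 ⊢
      linarith
    · exact hV k hk

lemma link_le_link_of_isMax {V : Set α} {E : Finset (Finset α)} {x : α → ℝ}
    (hx : x ∈ weightings V) (hmax : ∀ z ∈ weightings V, weight E z ≤ weight E x) {i j : α}
    (hi : i ∈ V) (hj : 0 < x j) : link E x i ≤ link E x j := by
  by_contra! hlt
  have hij : i ≠ j := by rintro rfl; exact lt_irrefl _ hlt
  set c := codeg E x i j with hc
  have hc0 : 0 ≤ c := codeg_nonneg hx.1.1 i j
  set d := link E x i - link E x j with hd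
  have hd0 : 0 < d := sub_pos.2 hlt
  set ε := min (x j) (d / (c + 1)) with hε
  have hε0 : 0 < ε := lt_min hj (by positivity)
  have h2 : ε * (c + 1) ≤ d := by
    rw [← le_div_iff₀ (by positivity)]
    exact min_le_right _ _
  have := hmax _ (shift_mem_weightings hx hij hi hε0.le (min_le_left _ _))
  rw [weight_shift E x hij, ← hd, ← hc] at this
  nlinarith

/-- The first order condition at a maximizer: on its support all links carry the same weight,
which Euler's identity determines. -/
lemma link_eq_of_isMax {V : Set α} {E : Finset (Finset α)} {r : ℕ} {x : α → ℝ}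
    (hE : ∀ e ∈ E, e.card = r) (hx : x ∈ weightings V)
    (hmax : ∀ z ∈ weightings V, weight E z ≤ weight E x) {i : α} (hi : 0 < x i) :
    link E x i = r * weight E x := by
  have hmem : ∀ j, 0 < x j → j ∈ V := fun j hj => by
    by_contra h
    exact hj.ne' (hx.2 j h)
  have : ∀ j, x j * link E x j = x j * link E x i := by
    intro j
    rcases (hx.1.1 j).eq_or_lt with h | h
    · rw [← h]; simp
    · rw [(link_le_link_of_isMax hx hmax (hmem j h) hi).antisymm
        (link_le_link_of_isMax hx hmax (hmem i hi) h)]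
  rw [← sum_mul_link hE x, sum_congr rfl fun j _ => this j, ← sum_mul, hx.1.2, one_mul]

lemma weightings_nonempty {V : Set α} (hV : V.Nonempty) : (weightings V).Nonempty := by
  obtain ⟨v, hv⟩ := hV
  refine ⟨Pi.single v 1, single_mem_stdSimplex ℝ v, fun i hi => ?_⟩
  have : i ≠ v := fun h => hi (h ▸ hv)
  simp [this]

lemma exists_isMax_weight (E : Finset (Finset α)) {V : Set α} (hV : V.Nonempty) :
    ∃ x ∈ weightings V, ∀ z ∈ weightings V, weight E z ≤ weight E x :=
  (isCompact_weightings V).exists_isMaxOn (weightings_nonempty hV)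
    (continuous_weight E).continuousOn

/-- Among the families with a given property, some family and some weighting together reach
the largest value. -/
lemma exists_extremal (P : Finset (Finset α) → Prop) (hP : ∃ E, P E) {V : Set α}
    (hV : V.Nonempty) :
    ∃ E x, P E ∧ x ∈ weightings V ∧
      ∀ E' z, P E' → z ∈ weightings V → weight E' z ≤ weight E x := by
  classical
  choose m hm hmax using fun E : Finset (Finset α) => exists_isMax_weight E hV
  obtain ⟨E, hE, h⟩ := exists_max_image (univ.filter P) (fun E => weight E (m E))
    (by obtain ⟨E, hE⟩ := hP; exact ⟨E, by simpa using hE⟩)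
  refine ⟨E, m E, by simpa using hE, hm E, fun E' z hE' hz => ?_⟩
  exact (hmax E' z hz).trans (h E' (by simpa using hE'))

end Simplex

/-! ### Maclaurin's inequality -/

section Maclaurin

variable [DecidableEq α]

/-- The part of `link E x i` coming from the edges that avoid `j`. -/
noncomputable def linkAvoid (E : Finset (Finset α)) (x : α → ℝ) (i j : α) : ℝ :=
  ∑ e ∈ E with i ∈ e ∧ j ∉ e, ∏ k ∈ e.erase i, x k

lemma link_eq_codeg_add (E : Finset (Finset α)) (x : α → ℝ) {i j : α} (hij : i ≠ j) :
    link E x i = x j * codeg E x i j + linkAvoid E x i j := by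
  unfold link codeg linkAvoid
  rw [← sum_filter_add_sum_filter_not _ (fun e => j ∈ e), filter_filter, filter_filter, mul_sum]
  congr 1
  refine sum_congr rfl fun e he => ?_
  rw [mul_prod_erase]
  simp only [mem_filter] at he
  exact mem_erase.2 ⟨hij.symm, he.2.2⟩

lemma codeg_comm (E : Finset (Finset α)) (x : α → ℝ) (i j : α) :
    codeg E x i j = codeg E x j i := by
  unfold codeg
  simp only [and_comm (a := i ∈ _)]
  exact sum_congr rfl fun e _ => by rw [erase_right_comm]

/-- For the complete family the link difference is the codegree times the difference of the
weights. -/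
lemma link_sub_link_powersetCard {S : Finset α} (r : ℕ) (x : α → ℝ) {i j : α} (hi : i ∈ S)
    (hj : j ∈ S) (hij : i ≠ j) :
    link (powersetCard r S) x i - link (powersetCard r S) x j =
      (x j - x i) * codeg (powersetCard r S) x i j := by
  set E := powersetCard r S
  have hswap : linkAvoid E x i j = linkAvoid E x j i := by
    unfold linkAvoid
    refine sum_bij' (fun e _ => insert j (e.erase i)) (fun e _ => insert i (e.erase j))
      ?_ ?_ ?_ ?_ ?_
    · intro e he
      simp only [E, mem_filter, mem_powersetCard] at he ⊢
      refine ⟨⟨insert_subset hj ((erase_subset _ _).trans he.1.1), ?_⟩, by simp, by simp [hij]⟩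
      rw [card_insert_of_notMem (by simp [he.2.2]), card_erase_add_one he.2.1, he.1.2]
    · intro e he
      simp only [E, mem_filter, mem_powersetCard] at he ⊢
      refine ⟨⟨insert_subset hi ((erase_subset _ _).trans he.1.1), ?_⟩, by simp,
        by simp [hij.symm]⟩
      rw [card_insert_of_notMem (by simp [he.2.2]), card_erase_add_one he.2.1, he.1.2]
    · intro e he
      simp only [mem_filter] at he
      rw [erase_insert (by simp [he.2.2]), insert_erase he.2.1]
    · intro e he
      simp only [mem_filter] at he
      rw [erase_insert (by simp [he.2.2]), insert_erase he.2.1]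
    · intro e he
      simp only [mem_filter] at he
      rw [erase_insert (by simp [he.2.2])]
  rw [link_eq_codeg_add E x hij, link_eq_codeg_add E x hij.symm, codeg_comm E x j i, hswap]
  ring

lemma codeg_powersetCard_pos {S : Finset α} {r : ℕ} {x : α → ℝ} (hx : ∀ i, 0 ≤ x i) {i j : α}
    (hij : i ≠ j) (hi : i ∈ S) (hj : j ∈ S) {U : Finset α} (hU : U ⊆ S)
    (hUpos : ∀ k ∈ U, 0 < x k) (hcard : r ≤ (insert i (insert j U)).card) (hr : 2 ≤ r) :
    0 < codeg (powersetCard r S) x i j := by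
  obtain ⟨e, he1, he2, he3⟩ := exists_subsuperset_card_eq (s := {i, j}) (t := insert i (insert j U))
    (n := r) (by intro k; simp; tauto) (by rw [card_pair hij]; exact hr) hcard
  unfold codeg
  refine sum_pos' (fun e _ => prod_nonneg fun k _ => hx k) ⟨e, ?_, ?_⟩
  · simp only [mem_filter, mem_powersetCard]
    exact ⟨⟨he2.trans (insert_subset hi (insert_subset hj hU)), he3⟩,
      he1 (by simp), he1 (by simp)⟩
  · refine prod_pos fun k hk => hUpos k ?_
    simp only [mem_erase] at hk
    have := he2 hk.2.2
    simp only [mem_insert] at this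
    tauto

/-- Maclaurin's inequality on the simplex. A maximizer is uniform: two different weights, one of
them positive, would violate the first order condition. -/
lemma weight_powersetCard_le [Fintype α] {S : Finset α} {r : ℕ} (hr : 2 ≤ r) {x : α → ℝ}
    (hx : x ∈ weightings (S : Set α)) :
    weight (powersetCard r S) x ≤ S.card.choose r * (1 / (S.card : ℝ)) ^ r := by
  rcases lt_or_ge S.card r with hlt | hle
  · rw [powersetCard_eq_empty.2 hlt, Nat.choose_eq_zero_of_lt hlt]
    simp [weight]
  have hSne : S.Nonempty := card_pos.1 (by omega)
  have hS0 : (0 : ℝ) < S.card := by exact_mod_cast hSne.card_pos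
  obtain ⟨m, hm, hmax⟩ := exists_isMax_weight (powersetCard r S) (V := (S : Set α)) hSne
  have hunif : (fun i => if i ∈ S then 1 / (S.card : ℝ) else 0) ∈ weightings (S : Set α) := by
    refine ⟨⟨fun i => by dsimp only; split_ifs <;> positivity, ?_⟩,
      fun i hi => if_neg (by simpa using hi)⟩
    rw [← sum_filter, sum_const]
    simp [hS0.ne']
  have hmpos : 0 < weight (powersetCard r S) m := by
    refine lt_of_lt_of_le ?_ (hmax _ hunif)
    rw [weight_powersetCard_const r (c := 1 / (S.card : ℝ)) fun i hi => if_pos hi]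
    have : 0 < S.card.choose r := Nat.choose_pos hle
    positivity
  obtain ⟨e, he, hepos⟩ : ∃ e ∈ powersetCard r S, 0 < ∏ i ∈ e, m i :=
    exists_lt_of_sum_lt (by simpa [weight] using hmpos)
  have heS : e ⊆ S := (mem_powersetCard.1 he).1
  have hecard : e.card = r := (mem_powersetCard.1 he).2
  have hepos' : ∀ k ∈ e, 0 < m k := fun k hk =>
    (hm.1.1 k).lt_of_ne fun h => hepos.ne' (prod_eq_zero hk h.symm)
  have hle' : ∀ i ∈ S, ∀ j ∈ S, m i ≤ m j := by
    intro i hi j hj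
    by_contra! hlt
    have hij : i ≠ j := by rintro rfl; exact lt_irrefl _ hlt
    have h1 := link_le_link_of_isMax hm hmax (i := j) (j := i) hj ((hm.1.1 j).trans_lt hlt)
    have h2 := link_sub_link_powersetCard r m hi hj hij
    have h3 := codeg_powersetCard_pos hm.1.1 hij hi hj heS hepos'
      (by rw [← hecard]; exact card_le_card fun k hk => by simp [hk]) hr
    nlinarith
  obtain ⟨k, hk⟩ := hSne
  have hconst : ∀ i ∈ S, m i = m k := fun i hi => (hle' i hi k hk).antisymm (hle' k hk i hi)
  have hmk : m k = 1 / (S.card : ℝ) := by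
    have := sum_eq_one_of_mem_weightings hm
    rw [sum_congr rfl hconst, sum_const, nsmul_eq_mul] at this
    field_simp
    linarith
  refine (hmax x hx).trans_eq ?_
  rw [weight_powersetCard_const r hconst, hmk]

end Maclaurin

lemma weight_powersetCard_one (S : Finset α) (x : α → ℝ) :
    weight (powersetCard 1 S) x = ∑ i ∈ S, x i := by
  unfold weight
  rw [powersetCard_one, sum_map]
  simp

/-! ### Motzkin and Straus with singletons -/

section MotzkinStraus

variable [DecidableEq α]

lemma weight_powersetCard_succ_insert {S : Finset α} {a : α} (ha : a ∉ S) (k : ℕ) (x : α → ℝ) :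
    weight (powersetCard (k + 1) (insert a S)) x =
      weight (powersetCard (k + 1) S) x + x a * weight (powersetCard k S) x := by
  unfold weight
  rw [powersetCard_succ_insert ha, sum_union, sum_image, mul_sum]
  · congr 1
    refine sum_congr rfl fun e he => prod_insert fun h => ha ((mem_powersetCard.1 he).1 h)
  · intro e he f hf hef
    have he' : a ∉ e := fun h => ha ((mem_powersetCard.1 he).1 h)
    have hf' : a ∉ f := fun h => ha ((mem_powersetCard.1 hf).1 h)
    rw [← erase_insert he', ← erase_insert hf', hef]
  · rw [disjoint_left]
    intro e he he'
    obtain ⟨f, -, rfl⟩ := mem_image.1 he'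
    exact ha ((mem_powersetCard.1 he).1 (mem_insert_self a f))

lemma weight_powersetCard_two (S : Finset α) (x : α → ℝ) :
    weight (powersetCard 2 S) x = ((∑ i ∈ S, x i) ^ 2 - ∑ i ∈ S, x i ^ 2) / 2 := by
  induction S using Finset.induction_on with
  | empty => rw [powersetCard_eq_empty.2 (by simp)]; simp [weight]
  | insert a S ha ih =>
    rw [weight_powersetCard_succ_insert ha, weight_powersetCard_one, ih, sum_insert ha,
      sum_insert ha]
    ring

lemma codeg_eq_zero_of_card_one {E : Finset (Finset α)} (hE : ∀ e ∈ E, e.card = 1) (x : α → ℝ)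
    {i j : α} (hij : i ≠ j) : codeg E x i j = 0 := by
  unfold codeg
  rw [filter_eq_empty_iff.2, sum_empty]
  rintro e he ⟨hi, hj⟩
  exact hij (card_le_one.1 (hE e he).le i hi j hj)

lemma codeg_eq_zero_of_pair_notMem {E : Finset (Finset α)} (hE : ∀ e ∈ E, e.card = 2)
    (x : α → ℝ) {i j : α} (hij : i ≠ j) (h : {i, j} ∉ E) : codeg E x i j = 0 := by
  unfold codeg
  rw [filter_eq_empty_iff.2, sum_empty]
  rintro e he ⟨hi, hj⟩
  refine h ?_
  rwa [eq_of_subset_of_card_le (s := {i, j}) (t := e)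
    (insert_subset hi (singleton_subset_iff.2 hj)) (by rw [hE e he, card_pair hij])]

/-- The Motzkin–Straus bound for `{1,2}`-graphs, where `E₁` consists of singletons and `E₂` of
pairs. Moving weight between two non-adjacent vertices is an affine change, so the support may be
taken to be a clique; on a clique the bound is the Cauchy–Schwarz inequality. -/
lemma motzkin_straus [Fintype α] {E₁ E₂ : Finset (Finset α)} (h₁ : ∀ e ∈ E₁, e.card = 1)
    (h₂ : ∀ e ∈ E₂, e.card = 2) {t : ℕ} (ht : 2 ≤ t)
    (hclique : ∀ S : Finset α, (∀ i ∈ S, {i} ∈ E₁) → powersetCard 2 S ⊆ E₂ → S.card ≤ t)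
    {x : α → ℝ} (hx : x ∈ weightings (Set.univ : Set α)) :
    weight E₁ x + 2 * weight E₂ x ≤ 2 - 1 / t := by
  induction hn : (univ.filter fun i => 0 < x i).card using Nat.strong_induction_on
    generalizing x with
  | _ n ih =>
  set W := univ.filter fun i => 0 < x i with hW
  have hx0 : ∀ i, i ∉ W → x i = 0 := fun i hi => by
    simp only [hW, mem_filter, mem_univ, true_and, not_lt] at hi
    exact hi.antisymm (hx.1.1 i)
  by_cases hW2 : powersetCard 2 W ⊆ E₂
  · -- The support is a clique.
    set W₁ := W.filter fun i => {i} ∈ E₁ with hW₁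
    have hcard : W₁.card ≤ t := by
      refine hclique W₁ (fun i hi => (mem_filter.1 hi).2) ?_
      exact (powersetCard_mono (filter_subset _ _)).trans hW2
    have hsum1 : weight E₁ x = ∑ i ∈ W₁, x i := by
      rw [← weight_powersetCard_one]
      symm
      refine sum_subset ?_ ?_
      · intro e he
        obtain ⟨i, rfl⟩ := card_eq_one.1 (mem_powersetCard.1 he).2
        have := (mem_powersetCard.1 he).1 (mem_singleton_self i)
        exact (mem_filter.1 this).2
      · intro e he hne
        obtain ⟨i, rfl⟩ := card_eq_one.1 (h₁ e he)
        rw [prod_singleton]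
        refine hx0 i fun hi => hne ?_
        rw [mem_powersetCard]
        refine ⟨singleton_subset_iff.2 ?_, card_singleton i⟩
        rw [hW₁, mem_filter]
        exact ⟨hi, he⟩
    have hsum2 : 2 * weight E₂ x ≤ 1 - ∑ i, x i ^ 2 := by
      have : weight E₂ x ≤ weight (powersetCard 2 univ) x :=
        weight_mono hx.1.1 fun e he => mem_powersetCard.2 ⟨subset_univ _, h₂ e he⟩
      rw [weight_powersetCard_two, hx.1.2] at this
      linarith
    set a := ∑ i ∈ W₁, x i with ha
    have ha0 : 0 ≤ a := sum_nonneg fun i _ => hx.1.1 i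
    have ha1 : a ≤ 1 := by
      rw [← hx.1.2]
      exact sum_le_sum_of_subset_of_nonneg (subset_univ _) fun i _ _ => hx.1.1 i
    have ht0 : (2 : ℝ) ≤ t := by exact_mod_cast ht
    have hcs : a ^ 2 ≤ t * ∑ i, x i ^ 2 := by
      refine (sq_sum_le_card_mul_sum_sq (s := W₁) (f := x)).trans ?_
      refine mul_le_mul (by exact_mod_cast hcard) ?_ (sum_nonneg fun i _ => sq_nonneg _)
        (by positivity)
      exact sum_le_sum_of_subset_of_nonneg (subset_univ _) fun i _ _ => sq_nonneg _
    have hcs' : a ^ 2 / t ≤ ∑ i, x i ^ 2 := by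
      rw [div_le_iff₀ (by positivity)]
      linarith
    have hfin : a + (1 - a ^ 2 / t) ≤ 2 - 1 / t := by
      have : 0 ≤ (1 - a) * (t - (1 + a)) / t := by
        refine div_nonneg (mul_nonneg ?_ ?_) ?_ <;> linarith
      have h2 : 2 - 1 / t - (a + (1 - a ^ 2 / t)) = (1 - a) * (t - (1 + a)) / t := by
        field_simp
        ring
      linarith
    rw [hsum1]
    linarith
  · -- Two non-adjacent vertices in the support: empty one of them.
    obtain ⟨e, heW, heE⟩ := not_subset.1 hW2
    obtain ⟨heW, hcard⟩ := mem_powersetCard.1 heW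
    obtain ⟨i, j, hij, rfl⟩ := card_eq_two.1 hcard
    have hi : i ∈ W := heW (by simp)
    have hj : j ∈ W := heW (by simp)
    have step : ∀ a b : α, a ≠ b → a ∈ W → b ∈ W → {a, b} ∉ E₂ →
        0 ≤ link E₁ x a - link E₁ x b + 2 * (link E₂ x a - link E₂ x b) →
        weight E₁ x + 2 * weight E₂ x ≤ 2 - 1 / t := by
      intro a b hab ha hb hE hge
      have hb0 : 0 < x b := (mem_filter.1 hb).2
      have hz := shift_mem_weightings hx hab (Set.mem_univ a) hb0.le le_rfl
      refine le_trans ?_ (ih _ ?_ hz rfl)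
      · rw [weight_shift _ _ hab, weight_shift _ _ hab, codeg_eq_zero_of_card_one h₁ x hab,
          codeg_eq_zero_of_pair_notMem h₂ x hab hE]
        nlinarith
      · rw [← hn]
        refine card_lt_card ⟨?_, fun h => ?_⟩
        · intro k hk
          rw [mem_filter] at hk ⊢
          refine ⟨mem_univ k, ?_⟩
          by_cases hka : k = a
          · rw [hka]
            exact (mem_filter.1 ha).2
          · by_cases hkb : k = b
            · rw [hkb]
              exact hb0
            · simpa [shift, hka, hkb] using hk.2
        · have := (mem_filter.1 (h hb)).2
          simp [shift, hab.symm] at this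
    rcases le_total 0 (link E₁ x i - link E₁ x j + 2 * (link E₂ x i - link E₂ x j)) with h | h
    · exact step i j hij hi hj heE h
    · refine step j i hij.symm hj hi (by rwa [pair_comm]) ?_
      linarith

end MotzkinStraus

/-! ### Incidences -/

section Incidence

variable [DecidableEq α]

/-- Double counting of the incidences between the points of `S` and the members of `M`. -/
lemma sum_card_filter_mem_mul {S : Finset α} {M : Finset (Finset α)} (hM : ∀ e ∈ M, e ⊆ S)
    (x : α → ℝ) :
    ∑ i ∈ S, ((M.filter fun e => i ∈ e).card : ℝ) * x i = ∑ e ∈ M, ∑ i ∈ e, x i := by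
  have h : ∀ e ∈ M, ∑ i ∈ e, x i = ∑ i ∈ S, if i ∈ e then x i else 0 := by
    intro e he
    rw [← sum_filter, filter_mem_eq_inter, inter_eq_right.2 (hM e he)]
  rw [sum_congr rfl h, sum_comm]
  refine sum_congr rfl fun i _ => ?_
  rw [← sum_filter, sum_const, nsmul_eq_mul]

lemma sum_card_filter_mem {S : Finset α} {M : Finset (Finset α)} {k : ℕ}
    (hM : M ⊆ powersetCard k S) :
    ∑ i ∈ S, ((M.filter fun e => i ∈ e).card : ℝ) = k * M.card := by
  have := sum_card_filter_mem_mul (fun e he => (mem_powersetCard.1 (hM he)).1) (fun _ => (1 : ℝ))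
  simp only [mul_one] at this
  rw [this, sum_congr rfl (g := fun _ => (k : ℝ)) fun e he => by
    simp [(mem_powersetCard.1 (hM he)).2]]
  simp [mul_comm]

lemma card_filter_mem_add_le {M : Finset (Finset α)} (hM : ∀ e ∈ M, e.card = 2) {i j : α}
    (hij : i ≠ j) :
    (M.filter fun e => i ∈ e).card + (M.filter fun e => j ∈ e).card ≤ M.card + 1 := by
  rw [← card_union_add_card_inter]
  refine add_le_add (card_le_card (union_subset (filter_subset _ _) (filter_subset _ _))) ?_
  rw [← card_singleton ({i, j} : Finset α)]
  refine card_le_card fun e he => ?_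
  simp only [mem_inter, mem_filter] at he
  rw [mem_singleton]
  exact (eq_of_subset_of_card_le (insert_subset he.1.2 (singleton_subset_iff.2 he.2.2))
    (by rw [hM e he.1.1, card_pair hij])).symm

lemma link_powersetCard_succ {S : Finset α} {i : α} (hi : i ∈ S) (k : ℕ) (x : α → ℝ) :
    link (powersetCard (k + 1) S) x i = weight (powersetCard k (S.erase i)) x := by
  unfold link weight
  refine sum_bij' (fun e _ => e.erase i) (fun e _ => insert i e) ?_ ?_ ?_ ?_ ?_
  · intro e he
    simp only [mem_filter, mem_powersetCard] at he ⊢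
    exact ⟨erase_subset_erase _ he.1.1, by rw [card_erase_of_mem he.2, he.1.2]; rfl⟩
  · intro e he
    simp only [mem_filter, mem_powersetCard] at he ⊢
    have hie : i ∉ e := fun h => (mem_erase.1 (he.1 h)).1 rfl
    exact ⟨⟨insert_subset hi (he.1.trans (erase_subset _ _)),
      by rw [card_insert_of_notMem hie, he.2]⟩, mem_insert_self _ _⟩
  · intro e he
    exact insert_erase (mem_filter.1 he).2
  · intro e he
    exact erase_insert fun h => (mem_erase.1 ((mem_powersetCard.1 he).1 h)).1 rfl
  · intro e he
    rfl

lemma sum_link_powersetCard_three (S : Finset α) (x : α → ℝ) :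
    ∑ i ∈ S, link (powersetCard 3 S) x i =
      ((S.card : ℝ) - 2) * weight (powersetCard 2 S) x := by
  have h : ∀ i ∈ S, link (powersetCard 3 S) x i =
      ((∑ j ∈ S, x j) ^ 2 - ∑ j ∈ S, x j ^ 2) / 2 - (∑ j ∈ S, x j) * x i + x i ^ 2 := by
    intro i hi
    rw [link_powersetCard_succ hi 2, weight_powersetCard_two, sum_erase_eq_sub hi,
      sum_erase_eq_sub hi]
    ring
  rw [sum_congr rfl h, weight_powersetCard_two, sum_add_distrib, sum_sub_distrib, ← mul_sum,
    sum_const, nsmul_eq_mul]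
  ring

lemma sum_powersetCard_two_sum {S : Finset α} (x : α → ℝ) :
    ∑ P ∈ powersetCard 2 S, ∑ i ∈ P, x i = ((S.card : ℝ) - 1) * ∑ i ∈ S, x i := by
  rw [← sum_card_filter_mem_mul (S := S) fun e he => (mem_powersetCard.1 he).1, mul_sum]
  refine sum_congr rfl fun i hi => ?_
  have h := link_powersetCard_succ hi 1 (fun _ => (1 : ℝ))
  rw [weight_powersetCard_one] at h
  simp only [link, prod_const_one, sum_const, nsmul_eq_mul, mul_one] at h
  rw [show (1 : ℕ) + 1 = 2 from rfl] at h
  rw [h, card_erase_of_mem hi, Nat.cast_sub (card_pos.2 ⟨i, hi⟩)]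
  simp

end Incidence

/-! ### A quadratic inequality for degree sequences -/

section DegreeSequences

/-- A star has the largest sum of squared degrees among all graphs with `t - 1` edges on `t`
vertices; this is the version for real "degree sequences". -/
lemma sum_sq_le_of_pair_le {S : Finset α} {D : α → ℝ} {t : ℝ}
    (h0 : ∀ i ∈ S, 0 ≤ D i) (hpair : ∀ i ∈ S, ∀ j ∈ S, i ≠ j → D i + D j ≤ t)
    (h1 : ∀ i ∈ S, D i ≤ t - 1) (hsum : ∑ i ∈ S, D i = 2 * (t - 1)) :
    ∑ i ∈ S, D i ^ 2 ≤ t * (t - 1) := by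
  classical
  by_cases hbig : ∃ a ∈ S, t / 2 < D a
  · obtain ⟨a, ha, hat⟩ := hbig
    have h2 : ∑ i ∈ S.erase a, D i ^ 2 ≤ ∑ i ∈ S.erase a, (t - D a) * D i := by
      refine sum_le_sum fun i hi => ?_
      have hi' := mem_erase.1 hi
      rw [sq]
      exact mul_le_mul_of_nonneg_right (by linarith [hpair i hi'.2 a ha hi'.1]) (h0 i hi'.2)
    rw [← mul_sum, sum_erase_eq_sub ha, sum_erase_eq_sub ha, hsum] at h2
    nlinarith [h1 a ha]
  · push Not at hbig
    have h2 : ∑ i ∈ S, D i ^ 2 ≤ ∑ i ∈ S, t / 2 * D i := by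
      refine sum_le_sum fun i hi => ?_
      rw [sq]
      exact mul_le_mul_of_nonneg_right (hbig i hi) (h0 i hi)
    rw [← mul_sum, hsum] at h2
    linarith

/-- The quadratic inequality behind the bounds for `3`-graphs. Here `1 - ∑ x` is the weight
outside `S`, and `D` plays the role of the degree sequence of the pairs of `S` missing in a link.
The two sides differ by a multiple of
`∑ ((t - 2) (x_i - 1 / t) + (1 - ∑ x) (D_i - 1))²` plus a nonnegative term. -/
lemma quadratic_le [DecidableEq α] {S : Finset α} {t : ℕ} (hS : S.card = t) (ht : 3 ≤ t)
    {x D : α → ℝ} (hD : ∑ i ∈ S, D i = 2 * ((t : ℝ) - 1))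
    (hD2 : ∑ i ∈ S, D i ^ 2 ≤ t * ((t : ℝ) - 1)) :
    ((t : ℝ) - 2) * weight (powersetCard 2 S) x +
      (1 - ∑ i ∈ S, x i) * (((t : ℝ) - 1) * ∑ i ∈ S, x i - ∑ i ∈ S, D i * x i) ≤
      ((t : ℝ) - 1) * (t - 2) / (2 * t) := by
  have ht' : (3 : ℝ) ≤ t := by exact_mod_cast ht
  rw [weight_powersetCard_two]
  set P := ∑ i ∈ S, x i with hP
  set Q := ∑ i ∈ S, x i ^ 2 with hQ
  set Z := ∑ i ∈ S, D i * x i with hZ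
  set D2 := ∑ i ∈ S, D i ^ 2 with hD2'
  have hsq : 0 ≤ ∑ i ∈ S, (((t : ℝ) - 2) * (x i - 1 / t) + (1 - P) * (D i - 1)) ^ 2 :=
    sum_nonneg fun i _ => sq_nonneg _
  have hexp : ∑ i ∈ S, (((t : ℝ) - 2) * (x i - 1 / t) + (1 - P) * (D i - 1)) ^ 2 =
      ((t : ℝ) - 2) ^ 2 * (Q - 2 * P / t + 1 / t) +
        2 * (t - 2) * (1 - P) * (Z - P - 2 * (t - 1) / t + 1) +
        (1 - P) ^ 2 * (D2 - 4 * (t - 1) + t) := by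
    have : ∀ i ∈ S, (((t : ℝ) - 2) * (x i - 1 / t) + (1 - P) * (D i - 1)) ^ 2 =
        ((t : ℝ) - 2) ^ 2 * x i ^ 2 + (2 * (t - 2) * (1 - P)) * (D i * x i) +
          (1 - P) ^ 2 * D i ^ 2 +
          (-2 * ((t : ℝ) - 2) ^ 2 / t - 2 * (t - 2) * (1 - P)) * x i +
          (-2 * (t - 2) * (1 - P) / t - 2 * (1 - P) ^ 2) * D i +
          (((t : ℝ) - 2) / t - (1 - P)) ^ 2 + 4 * (t - 2) / t * (1 - P) := by
      intro i _
      field_simp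
      ring
    rw [sum_congr rfl this]
    simp only [sum_add_distrib, ← mul_sum, sum_const, nsmul_eq_mul, hS, hD, ← hP, ← hQ, ← hZ,
      ← hD2']
    field_simp
    ring
  rw [hexp] at hsq
  have h3 : (1 - P) ^ 2 * (D2 - 4 * (t - 1) + t) ≤ (1 - P) ^ 2 * ((t : ℝ) - 2) ^ 2 :=
    mul_le_mul_of_nonneg_left (by linarith) (sq_nonneg _)
  have h4 : 0 ≤ ((t : ℝ) - 2) * (((t : ℝ) - 2) * (Q - 2 * P / t + 1 / t) +
      2 * (1 - P) * (Z - P - 2 * (t - 1) / t + 1) + (1 - P) ^ 2 * (t - 2)) := by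
    linarith
  have h5 := nonneg_of_mul_nonneg_right h4 (by linarith)
  have h6 : ((t : ℝ) - 1) * (t - 2) / (2 * t) - (((t : ℝ) - 2) * ((P ^ 2 - Q) / 2) +
      (1 - P) * (((t : ℝ) - 1) * P - Z)) = (((t : ℝ) - 2) * (Q - 2 * P / t + 1 / t) +
      2 * (1 - P) * (Z - P - 2 * (t - 1) / t + 1) + (1 - P) ^ 2 * (t - 2)) / 2 := by
    field_simp
    ring
  linarith

end DegreeSequences

/-! ### The link of an outer vertex in a 3-graph -/

section Links

variable [DecidableEq α]

lemma cast_choose_two (t : ℕ) (ht : 1 ≤ t) :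
    (t.choose 2 : ℝ) = ((t - 1).choose 2 : ℝ) + ((t : ℝ) - 1) := by
  obtain ⟨n, rfl⟩ := Nat.exists_eq_add_of_le' ht
  rw [Nat.choose_succ_succ]
  push_cast
  simp
  ring

/-- The bound for the link `A` in `S` of an outer vertex with at most `(t-1 choose 2)` pairs:
the missing pairs contain `t - 1` pairs, whose degrees are used in `quadratic_le`. The second
term records what is lost when `A` has fewer pairs. -/
lemma link_pairs_le {S : Finset α} {t : ℕ} (hS : S.card = t) (ht : 3 ≤ t) {x : α → ℝ} {μ : ℝ}
    (hμ : ∀ i ∈ S, μ ≤ x i) (hy : 0 ≤ 1 - ∑ i ∈ S, x i) {A : Finset (Finset α)}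
    (hA : A ⊆ powersetCard 2 S) (hcard : A.card ≤ (t - 1).choose 2) :
    (1 - ∑ i ∈ S, x i) * ∑ P ∈ A, ∑ i ∈ P, x i +
        2 * μ * (1 - ∑ i ∈ S, x i) * (((t - 1).choose 2 : ℝ) - A.card) ≤
      ((t : ℝ) - 1) * (t - 2) / (2 * t) - ((t : ℝ) - 2) * weight (powersetCard 2 S) x := by
  have hc2 := cast_choose_two t (by omega)
  have hMcard : ((powersetCard 2 S \ A).card : ℝ) = t.choose 2 - A.card := by
    rw [cast_card_sdiff hA, card_powersetCard, hS]
  have hcard' : (A.card : ℝ) ≤ ((t - 1).choose 2 : ℝ) := by exact_mod_cast hcard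
  obtain ⟨M, hM, hMc⟩ := exists_subset_card_eq (s := powersetCard 2 S \ A) (n := t - 1) (by
    have : ((t - 1 : ℕ) : ℝ) ≤ ((powersetCard 2 S \ A).card : ℝ) := by
      rw [hMcard, hc2, Nat.cast_sub (by omega)]
      push_cast
      linarith
    exact_mod_cast this)
  have hMc' : (M.card : ℝ) = t - 1 := by
    rw [hMc, Nat.cast_sub (by omega)]
    simp
  have hMS : M ⊆ powersetCard 2 S := hM.trans sdiff_subset
  set D : α → ℝ := fun i => ((M.filter fun e => i ∈ e).card : ℝ) with hDdef
  have hD : ∑ i ∈ S, D i = 2 * ((t : ℝ) - 1) := by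
    rw [hDdef, sum_card_filter_mem hMS, hMc']
    norm_num
  have hDle : ∀ i, D i ≤ t - 1 := fun i => by
    rw [← hMc']
    exact Nat.cast_le.2 (card_le_card (filter_subset _ _))
  have hDpair : ∀ i j, i ≠ j → D i + D j ≤ t := fun i j hij => by
    have := card_filter_mem_add_le (M := M) (fun e he => (mem_powersetCard.1 (hMS he)).2) hij
    have : D i + D j ≤ M.card + 1 := by simp only [hDdef]; exact_mod_cast this
    linarith
  have hq := quadratic_le hS ht (x := x) hD (sum_sq_le_of_pair_le (fun i _ => by positivity)
    (fun i _ j _ hij => hDpair i j hij) (fun i _ => hDle i) hD)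
  rw [sum_card_filter_mem_mul (fun e he => (mem_powersetCard.1 (hMS he)).1)] at hq
  -- The pairs outside `A ∪ M` weigh at least `2 μ` each.
  have hsplit : ∑ P ∈ A, ∑ i ∈ P, x i + ∑ P ∈ M, ∑ i ∈ P, x i +
      2 * μ * (((t - 1).choose 2 : ℝ) - A.card) ≤ ((t : ℝ) - 1) * ∑ i ∈ S, x i := by
    rw [← hS, ← sum_powersetCard_two_sum, ← sum_sdiff hA, ← sum_sdiff hM]
    have : ∑ P ∈ (powersetCard 2 S \ A) \ M, (2 * μ) ≤
        ∑ P ∈ (powersetCard 2 S \ A) \ M, ∑ i ∈ P, x i := by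
      refine sum_le_sum fun P hP => ?_
      have hP' := mem_powersetCard.1 (mem_sdiff.1 (mem_sdiff.1 hP).1).1
      have := card_nsmul_le_sum P x μ fun i hi => hμ i (hP'.1 hi)
      rwa [hP'.2, nsmul_eq_mul, Nat.cast_two] at this
    rw [sum_const, nsmul_eq_mul, cast_card_sdiff hM, hMcard, hMc', hc2] at this
    rw [hS]
    nlinarith
  nlinarith [mul_le_mul_of_nonneg_left hsplit hy]

/-- Among the multiplicities of the vertices in a family of more than `h` triples, one can select
a total of `2 h` with no vertex contributing more than `h / 2`. -/
lemma exists_selection {S : Finset α} {M : Finset (Finset α)} (hM : M ⊆ powersetCard 3 S) {h : ℕ}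
    (hh : 1 ≤ h) (hp : h + 1 ≤ M.card) :
    ∃ ρ : α → ℝ, (∀ i, 0 ≤ ρ i ∧ ρ i ≤ (M.filter fun e => i ∈ e).card ∧ ρ i ≤ (h : ℝ) / 2) ∧
      ∑ i ∈ S, ρ i = 2 * h := by
  set r : α → ℝ := fun i => ((M.filter fun e => i ∈ e).card : ℝ) with hr
  have hr0 : ∀ i, 0 ≤ r i := fun i => by positivity
  have hh' : (1 : ℝ) ≤ h := by exact_mod_cast hh
  have hp' : (h : ℝ) + 1 ≤ M.card := by exact_mod_cast hp
  set W := S.filter fun i => (h : ℝ) / 2 ≤ r i with hW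
  have hWS : W ⊆ S := filter_subset _ _
  have hsplit : ∑ i ∈ S, min (r i) ((h : ℝ) / 2) =
      ∑ e ∈ M, ((e \ W).card : ℝ) + W.card * ((h : ℝ) / 2) := by
    rw [← sum_sdiff hWS]
    congr 1
    · have h1 : ∀ i ∈ S \ W, min (r i) ((h : ℝ) / 2) = r i := fun i hi => by
        refine min_eq_left ?_
        by_contra! hlt
        exact (mem_sdiff.1 hi).2 (mem_filter.2 ⟨(mem_sdiff.1 hi).1, hlt.le⟩)
      have h2 := sum_card_filter_mem_mul (S := S) (M := M)
        (fun e he => (mem_powersetCard.1 (hM he)).1) (fun i => if i ∈ W then (0 : ℝ) else 1)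
      rw [sum_congr rfl h1]
      calc ∑ i ∈ S \ W, r i = ∑ i ∈ S, r i * (if i ∈ W then (0 : ℝ) else 1) := by
            rw [← sum_sdiff hWS]
            rw [sum_eq_zero (s := W) fun i hi => by simp [hi], add_zero]
            exact sum_congr rfl fun i hi => by simp [(mem_sdiff.1 hi).2]
        _ = _ := by
            rw [h2]
            refine sum_congr rfl fun e _ => ?_
            rw [← sum_sdiff (inter_subset_left (s₁ := e) (s₂ := W))]
            rw [sum_eq_zero (s := e ∩ W) fun i hi => by simp [(mem_inter.1 hi).2], add_zero,
              sdiff_inter_self_left]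
            rw [sum_congr rfl (g := fun _ => (1 : ℝ)) fun i hi => by
              simp [(mem_sdiff.1 hi).2]]
            simp
    · rw [sum_congr rfl (g := fun _ => (h : ℝ) / 2) fun i hi =>
        min_eq_right (mem_filter.1 hi).2, sum_const, nsmul_eq_mul]
  have hpos : 2 * (h : ℝ) ≤ ∑ i ∈ S, min (r i) ((h : ℝ) / 2) := by
    rw [hsplit]
    have hcard3 : ∀ e ∈ M, e.card = 3 := fun e he => (mem_powersetCard.1 (hM he)).2
    have hnn : 0 ≤ ∑ e ∈ M, ((e \ W).card : ℝ) := sum_nonneg fun _ _ => by positivity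
    rcases le_or_gt 4 W.card with h4 | h4
    · have : (4 : ℝ) ≤ W.card := by exact_mod_cast h4
      nlinarith
    rcases le_or_gt 3 W.card with h3 | h3
    · -- All triples but possibly `W` itself leave `W`.
      have h5 : ∑ e ∈ M.erase W, (1 : ℝ) ≤ ∑ e ∈ M, ((e \ W).card : ℝ) := by
        refine (sum_le_sum fun e he => ?_).trans
          (sum_le_sum_of_subset_of_nonneg (erase_subset W M) fun _ _ _ => by positivity)
        have he' := mem_erase.1 he
        have : (e \ W).Nonempty := by
          rw [sdiff_nonempty]
          intro hsub
          exact he'.1 (eq_of_subset_of_card_le hsub (by rw [hcard3 e he'.2]; omega))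
        exact_mod_cast this.card_pos
      have h6 : (M.card : ℝ) - 1 ≤ ∑ e ∈ M.erase W, (1 : ℝ) := by
        rw [sum_const, nsmul_eq_mul, mul_one]
        have : M.card - 1 ≤ (M.erase W).card := pred_card_le_card_erase
        have : M.card ≤ (M.erase W).card + 1 := by omega
        have : (M.card : ℝ) ≤ (M.erase W).card + 1 := by exact_mod_cast this
        linarith
      have : (3 : ℝ) ≤ W.card := by exact_mod_cast h3
      nlinarith
    · have h5 : ∑ e ∈ M, ((3 : ℝ) - W.card) ≤ ∑ e ∈ M, ((e \ W).card : ℝ) := by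
        refine sum_le_sum fun e he => ?_
        have := le_card_sdiff W e
        rw [hcard3 e he] at this
        have : 3 ≤ (e \ W).card + W.card := by omega
        have : (3 : ℝ) ≤ (e \ W).card + W.card := by exact_mod_cast this
        linarith
      rw [sum_const, nsmul_eq_mul] at h5
      have : (W.card : ℝ) ≤ 2 := by exact_mod_cast (by omega : W.card ≤ 2)
      nlinarith
  obtain ⟨total, htotal⟩ : ∃ c, c = ∑ i ∈ S, min (r i) ((h : ℝ) / 2) := ⟨_, rfl⟩
  rw [← htotal] at hpos
  have htotal0 : 0 < total := by linarith
  have hle1 : 2 * (h : ℝ) / total ≤ 1 := (div_le_one htotal0).2 hpos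
  have hm0 : ∀ i, 0 ≤ min (r i) ((h : ℝ) / 2) := fun i => le_min (hr0 i) (by positivity)
  refine ⟨fun i => min (r i) ((h : ℝ) / 2) * (2 * h / total), fun i => ?_, ?_⟩
  · have hle : min (r i) ((h : ℝ) / 2) * (2 * h / total) ≤ min (r i) ((h : ℝ) / 2) :=
      mul_le_of_le_one_right (hm0 i) hle1
    exact ⟨mul_nonneg (hm0 i) (div_nonneg (by linarith) htotal0.le), hle.trans (min_le_left _ _),
      hle.trans (min_le_right _ _)⟩
  · rw [← sum_mul, ← htotal, mul_div_cancel₀ _ htotal0.ne']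

/-- The bound for the link `A` in `S` of an outer vertex with more than `(t-1 choose 2)` pairs,
at the price of some triples `M` of `S`: their multiplicities complete the degrees of the pairs
missing in `A` to a sequence to which `quadratic_le` applies. -/
lemma link_pairs_le_add {S : Finset α} {t : ℕ} (hS : S.card = t) (ht : 3 ≤ t) {x : α → ℝ} {μ : ℝ}
    (hμ : ∀ i ∈ S, μ ≤ x i) (hy : 0 ≤ 1 - ∑ i ∈ S, x i) {A : Finset (Finset α)}
    (hA : A ⊆ powersetCard 2 S) {h : ℕ} (hh : 1 ≤ h) (hcard : A.card = (t - 1).choose 2 + h)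
    {M : Finset (Finset α)} (hM : M ⊆ powersetCard 3 S) (hp : h + 1 ≤ M.card) :
    (1 - ∑ i ∈ S, x i) * ∑ P ∈ A, ∑ i ∈ P, x i +
        (1 - ∑ i ∈ S, x i) * ((3 * M.card - 2 * h) * μ) ≤
      ((t : ℝ) - 1) * (t - 2) / (2 * t) - ((t : ℝ) - 2) * weight (powersetCard 2 S) x +
        (1 - ∑ i ∈ S, x i) * ∑ e ∈ M, ∑ i ∈ e, x i := by
  have hc2 := cast_choose_two t (by omega)
  have hh' : (1 : ℝ) ≤ h := by exact_mod_cast hh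
  set N := powersetCard 2 S \ A with hN
  have hNS : N ⊆ powersetCard 2 S := sdiff_subset
  have hNcard : (N.card : ℝ) = t - 1 - h := by
    rw [hN, cast_card_sdiff hA, card_powersetCard, hS, hcard, hc2]
    push_cast
    ring
  obtain ⟨ρ, hρ, hρsum⟩ := exists_selection hM hh hp
  set d : α → ℝ := fun i => ((N.filter fun e => i ∈ e).card : ℝ) with hd
  have hdsum : ∑ i ∈ S, d i = 2 * N.card := by
    rw [hd, sum_card_filter_mem hNS]
    norm_num
  have hD : ∑ i ∈ S, (d i + ρ i) = 2 * ((t : ℝ) - 1) := by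
    rw [sum_add_distrib, hdsum, hρsum, hNcard]
    ring
  have hdle : ∀ i, d i ≤ N.card := fun i => by
    exact Nat.cast_le.2 (card_le_card (filter_subset _ _))
  have hdpair : ∀ i j, i ≠ j → d i + d j ≤ N.card + 1 := fun i j hij => by
    simp only [hd]
    exact_mod_cast card_filter_mem_add_le (M := N)
      (fun e he => (mem_powersetCard.1 (hNS he)).2) hij
  have hq := quadratic_le hS ht (x := x) hD (sum_sq_le_of_pair_le
    (fun i _ => add_nonneg (by positivity) (hρ i).1)
    (fun i _ j _ hij => by linarith [hdpair i j hij, (hρ i).2.2, (hρ j).2.2])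
    (fun i _ => by linarith [hdle i, (hρ i).2.2]) hD)
  have hsum : ∑ i ∈ S, (d i + ρ i) * x i = ∑ P ∈ N, ∑ i ∈ P, x i + ∑ i ∈ S, ρ i * x i := by
    simp only [add_mul, sum_add_distrib]
    rw [sum_card_filter_mem_mul (fun e he => (mem_powersetCard.1 (hNS he)).1)]
  have hsplit : ∑ P ∈ A, ∑ i ∈ P, x i = ((t : ℝ) - 1) * ∑ i ∈ S, x i -
      ∑ P ∈ N, ∑ i ∈ P, x i := by
    rw [← hS, ← sum_powersetCard_two_sum, ← sum_sdiff hA]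
    ring
  -- The unselected multiplicities weigh at least `μ` each.
  have hrest : ∑ i ∈ S, ρ i * x i + (3 * M.card - 2 * h) * μ ≤ ∑ e ∈ M, ∑ i ∈ e, x i := by
    rw [← sum_card_filter_mem_mul (fun e he => (mem_powersetCard.1 (hM he)).1)]
    have h1 : ∑ i ∈ S, (((M.filter fun e => i ∈ e).card : ℝ) - ρ i) * μ ≤
        ∑ i ∈ S, (((M.filter fun e => i ∈ e).card : ℝ) - ρ i) * x i :=
      sum_le_sum fun i hi => mul_le_mul_of_nonneg_left (hμ i hi) (by linarith [(hρ i).2.1])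
    rw [← sum_mul, sum_sub_distrib, sum_card_filter_mem hM, hρsum] at h1
    simp only [sub_mul, sum_sub_distrib] at h1
    push_cast at h1
    linarith
  rw [hsum] at hq
  rw [hsplit]
  nlinarith [mul_le_mul_of_nonneg_left hrest hy]

end Links

/-! ### Links of the largest weights in a 3-graph -/

section Triples

variable [DecidableEq α]

/-- The pairs of `S` that form an edge of `E` together with `v`. -/
def pairLink (E : Finset (Finset α)) (S : Finset α) (v : α) : Finset (Finset α) :=
  (powersetCard 2 S).filter fun P => insert v P ∈ E

/-- The contribution of the edge `e` to the sum of the links of the vertices of `S`. -/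
noncomputable def score (S : Finset α) (x : α → ℝ) (e : Finset α) : ℝ :=
  ∑ i ∈ e ∩ S, ∏ j ∈ e.erase i, x j

lemma sum_link_eq_sum_score (E : Finset (Finset α)) (S : Finset α) (x : α → ℝ) :
    ∑ i ∈ S, link E x i = ∑ e ∈ E, score S x e := by
  unfold link score
  simp only [sum_filter]
  rw [sum_comm]
  refine sum_congr rfl fun e _ => ?_
  rw [← sum_filter, filter_mem_eq_inter, inter_comm]

/-- A sum over a `3`-uniform family, split according to the number of points in `S`. -/
lemma sum_triples [Fintype α] {E : Finset (Finset α)} (hE : ∀ e ∈ E, e.card = 3) (S : Finset α)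
    (g : Finset α → ℝ) :
    ∑ e ∈ E, g e + ∑ e ∈ powersetCard 3 S \ E, g e =
      ∑ e ∈ powersetCard 3 S, g e + ∑ v ∈ Sᶜ, ∑ P ∈ pairLink E S v, g (insert v P) +
        ∑ e ∈ E with (e ∩ S).card ≤ 1, g e := by
  have h1 : ∑ e ∈ E, g e = ∑ e ∈ E with e ⊆ S, g e + ∑ e ∈ E with (e ∩ S).card = 2, g e +
      ∑ e ∈ E with (e ∩ S).card ≤ 1, g e := by
    rw [sum_filter, sum_filter, sum_filter, ← sum_add_distrib, ← sum_add_distrib]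
    refine sum_congr rfl fun e he => ?_
    have h3 := hE e he
    by_cases hs : e ⊆ S
    · rw [inter_eq_left.2 hs, h3]
      simp [hs]
    · have : (e ∩ S).card < 3 := by
        rw [← h3]
        exact card_lt_card ⟨inter_subset_left, fun h => hs (h.trans inter_subset_right)⟩
      by_cases h2 : (e ∩ S).card = 2
      · simp [hs, h2]
      · have : (e ∩ S).card ≤ 1 := by omega
        simp [hs, h2, this]
  have h2 : ∑ e ∈ E with (e ∩ S).card = 2, g e =
      ∑ v ∈ Sᶜ, ∑ P ∈ pairLink E S v, g (insert v P) := by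
    rw [sum_sigma']
    symm
    refine sum_bij (fun p _ => insert p.1 p.2) ?_ ?_ ?_ ?_
    · rintro ⟨v, P⟩ hp
      simp only [mem_sigma, mem_compl, pairLink, mem_filter, mem_powersetCard] at hp ⊢
      refine ⟨hp.2.2, ?_⟩
      rw [insert_inter_of_notMem hp.1, inter_eq_left.2 hp.2.1.1, hp.2.1.2]
    · rintro ⟨v, P⟩ hp ⟨w, Q⟩ hq heq
      simp only [mem_sigma, mem_compl, pairLink, mem_filter, mem_powersetCard] at hp hq heq
      have hPQ : P = Q := by
        have := congrArg (· ∩ S) heq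
        simpa [insert_inter_of_notMem hp.1, insert_inter_of_notMem hq.1,
          inter_eq_left.2 hp.2.1.1, inter_eq_left.2 hq.2.1.1] using this
      subst hPQ
      have hv : v ∈ insert w P := heq ▸ mem_insert_self v P
      rcases mem_insert.1 hv with rfl | h
      · rfl
      · exact absurd (hp.2.1.1 h) hp.1
    · intro e he
      simp only [mem_filter] at he
      have h3 := hE e he.1
      have h4 : (e \ S).card = 1 := by
        have := card_sdiff_add_card_inter e S
        omega
      obtain ⟨v, hv⟩ := card_eq_one.1 h4
      have hins : insert v (e ∩ S) = e := by
        rw [insert_eq, ← hv, sdiff_union_inter]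
      have hvS : v ∉ S := (mem_sdiff.1 (hv ▸ mem_singleton_self v : v ∈ e \ S)).2
      refine ⟨⟨v, e ∩ S⟩, ?_, hins⟩
      simp only [mem_sigma, mem_compl, pairLink, mem_filter, mem_powersetCard]
      exact ⟨hvS, ⟨inter_subset_right, he.2⟩, by rw [hins]; exact he.1⟩
    · rintro ⟨v, P⟩ _
      rfl
  have h3 : ∑ e ∈ E with e ⊆ S, g e + ∑ e ∈ powersetCard 3 S \ E, g e =
      ∑ e ∈ powersetCard 3 S, g e := by
    rw [← sum_sdiff (inter_subset_left (s₁ := powersetCard 3 S) (s₂ := E)),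
      sdiff_inter_self_left, add_comm]
    congr 1
    refine sum_congr ?_ fun _ _ => rfl
    ext e
    simp only [mem_filter, mem_inter, mem_powersetCard]
    exact ⟨fun h => ⟨⟨h.2, hE e h.1⟩, h.1⟩, fun h => ⟨h.2, h.1.1⟩⟩
  rw [h1, h2, ← h3]
  ring

lemma score_insert {S P : Finset α} {v : α} (hv : v ∉ S) (hP : P ∈ powersetCard 2 S)
    (x : α → ℝ) : score S x (insert v P) = x v * ∑ i ∈ P, x i := by
  obtain ⟨hPS, hc⟩ := mem_powersetCard.1 hP
  have hvP : v ∉ P := fun h => hv (hPS h)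
  unfold score
  rw [insert_inter_of_notMem hv, inter_eq_left.2 hPS]
  obtain ⟨a, b, hab, rfl⟩ := card_eq_two.1 hc
  simp only [mem_insert, mem_singleton, not_or] at hvP
  rw [sum_pair hab, sum_pair hab, show (insert v {a, b} : Finset α).erase a = {v, b} by grind,
    show (insert v {a, b} : Finset α).erase b = {v, a} by grind, prod_pair hvP.2, prod_pair hvP.1]
  ring

lemma score_eq_of_subset {S : Finset α} {a b c : α} (hab : a ≠ b) (hac : a ≠ c) (hbc : b ≠ c)
    (hS : {a, b, c} ⊆ S) (x : α → ℝ) :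
    score S x {a, b, c} = x b * x c + x a * x c + x a * x b := by
  unfold score
  rw [inter_eq_left.2 hS, sum_insert (by simp [hab, hac]), sum_pair hbc,
    show ({a, b, c} : Finset α).erase a = {b, c} by grind,
    show ({a, b, c} : Finset α).erase b = {a, c} by grind,
    show ({a, b, c} : Finset α).erase c = {a, b} by grind, prod_pair hbc, prod_pair hac,
    prod_pair hab]
  ring

lemma mul_sum_le_score {S e : Finset α} (he : e ∈ powersetCard 3 S) {x : α → ℝ} {z : ℝ}
    (hz : ∀ i ∈ S, z ≤ x i) (hz0 : 0 ≤ z) : z * ∑ i ∈ e, x i ≤ score S x e := by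
  obtain ⟨heS, hc⟩ := mem_powersetCard.1 he
  obtain ⟨a, b, c, hab, hac, hbc, rfl⟩ := card_eq_three.1 hc
  rw [score_eq_of_subset hab hac hbc heS, sum_insert (by simp [hab, hac]), sum_pair hbc]
  have ha := hz a (heS (by simp))
  have hb := hz b (heS (by simp))
  have hc := hz c (heS (by simp))
  nlinarith [mul_le_mul_of_nonneg_right ha (hz0.trans hb),
    mul_le_mul_of_nonneg_right hb (hz0.trans hc), mul_le_mul_of_nonneg_right hc (hz0.trans ha)]

lemma three_mul_sq_le_score {S e : Finset α} (he : e ∈ powersetCard 3 S) {x : α → ℝ} {μ : ℝ}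
    (hμ : ∀ i ∈ S, μ ≤ x i) (hμ0 : 0 ≤ μ) : 3 * μ ^ 2 ≤ score S x e := by
  refine le_trans ?_ (mul_sum_le_score he hμ hμ0)
  obtain ⟨heS, hc⟩ := mem_powersetCard.1 he
  have := card_nsmul_le_sum e x μ fun i hi => hμ i (heS hi)
  rw [hc, nsmul_eq_mul] at this
  push_cast at this
  nlinarith

lemma score_le_of_card_inter_le_one {S e : Finset α} (he : e.card = 3)
    (heS : (e ∩ S).card ≤ 1) {x : α → ℝ} {a b : ℝ} (hx : ∀ i, 0 ≤ x i)
    (ha : ∀ v, v ∉ S → x v ≤ a) (hb : ∀ v, v ∉ S → x v ≤ b) (ha0 : 0 ≤ a) (hb0 : 0 ≤ b) :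
    score S x e ≤ a * b := by
  unfold score
  rcases Nat.le_one_iff_eq_zero_or_eq_one.1 heS with h0 | h1
  · rw [card_eq_zero.1 h0, sum_empty]
    positivity
  · obtain ⟨i, hi⟩ := card_eq_one.1 h1
    have hie : i ∈ e := (mem_inter.1 (hi ▸ mem_singleton_self i : i ∈ e ∩ S)).1
    rw [hi, sum_singleton]
    have h2 : (e.erase i).card = 2 := by rw [card_erase_of_mem hie, he]
    have hout : ∀ j ∈ e.erase i, j ∉ S := fun j hj hjS => by
      have hj' := mem_erase.1 hj
      have : j ∈ e ∩ S := mem_inter.2 ⟨hj'.2, hjS⟩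
      rw [hi, mem_singleton] at this
      exact hj'.1 this
    obtain ⟨v, w, hvw, hvw'⟩ := card_eq_two.1 h2
    rw [hvw'] at hout ⊢
    rw [prod_pair hvw]
    exact mul_le_mul (ha v (hout v (by simp))) (hb w (hout w (by simp))) (hx w) ha0

lemma card_triples [Fintype α] {E : Finset (Finset α)} (hE : ∀ e ∈ E, e.card = 3) (S : Finset α) :
    (E.card : ℝ) + (powersetCard 3 S \ E).card =
      S.card.choose 3 + ∑ v ∈ Sᶜ, ((pairLink E S v).card : ℝ) +
        (E.filter fun e => (e ∩ S).card ≤ 1).card := by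
  have := sum_triples hE S (fun _ => (1 : ℝ))
  simpa using this

/-- The sum of the links of the vertices of `S`: the complete family on `S`, minus the missing
triples, plus the edges that leave `S`. -/
lemma sum_link_triples [Fintype α] {E : Finset (Finset α)} (hE : ∀ e ∈ E, e.card = 3) (S : Finset α)
    (x : α → ℝ) :
    ∑ i ∈ S, link E x i + ∑ e ∈ powersetCard 3 S \ E, score S x e =
      ((S.card : ℝ) - 2) * weight (powersetCard 2 S) x +
        ∑ v ∈ Sᶜ, x v * ∑ P ∈ pairLink E S v, ∑ i ∈ P, x i +
        ∑ e ∈ E with (e ∩ S).card ≤ 1, score S x e := by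
  rw [sum_link_eq_sum_score, sum_triples hE, ← sum_link_eq_sum_score, sum_link_powersetCard_three]
  congr 2
  refine sum_congr rfl fun v hv => ?_
  rw [mul_sum]
  exact sum_congr rfl fun P hP => score_insert (mem_compl.1 hv) (mem_filter.1 hP).1 x

lemma sum_compl_eq [Fintype α] {x : α → ℝ} (hx : x ∈ weightings (Set.univ : Set α))
    (S : Finset α) :
    ∑ v ∈ Sᶜ, x v = 1 - ∑ i ∈ S, x i := by
  rw [← hx.1.2, ← sum_add_sum_compl S]
  ring

/-- If no outer vertex of positive weight has more than `(t-1 choose 2)` pairs in its link, then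
the links over `S` sum to at most their value in a complete `3`-graph on `S` with uniform weights,
with an explicit loss. Edges with a single point in `S` are charged to missing triples and to
unused pairs of outer links. -/
lemma sum_link_le_of_light [Fintype α] {E : Finset (Finset α)} (hE : ∀ e ∈ E, e.card = 3)
    {S : Finset α} {t : ℕ} (hS : S.card = t) (ht : 3 ≤ t) {x : α → ℝ}
    (hx : x ∈ weightings (Set.univ : Set α))
    {μ : ℝ} (hμ0 : 0 ≤ μ) (hμ : ∀ i ∈ S, μ ≤ x i) (hout : ∀ v, v ∉ S → x v ≤ μ)
    (hy : 0 < 1 - ∑ i ∈ S, x i)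
    (hlight : ∀ v ∈ Sᶜ, 0 < x v → (pairLink E S v).card ≤ (t - 1).choose 2)
    (hcard : (E.card : ℝ) ≤ t.choose 3 + (t - 1).choose 2) :
    ∑ i ∈ S, link E x i ≤ ((t : ℝ) - 1) * (t - 2) / (2 * t) -
      μ * ∑ v ∈ Sᶜ, x v * (((t - 1).choose 2 : ℝ) - (pairLink E S v).card) -
      2 * (powersetCard 3 S \ E).card * μ ^ 2 := by
  set y := 1 - ∑ i ∈ S, x i with hydef
  have hysum : ∑ v ∈ Sᶜ, x v = y := sum_compl_eq hx S
  have hT := sum_link_triples hE S x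
  have hc := card_triples hE S
  rw [hS] at hT hc
  set L : ℝ := ((t - 1).choose 2 : ℝ) with hL
  set a : α → ℝ := fun v => ((pairLink E S v).card : ℝ) with ha
  set p : ℝ := ((powersetCard 3 S \ E).card : ℝ) with hp
  set c : ℝ := ((E.filter fun e => (e ∩ S).card ≤ 1).card : ℝ) with hcdef
  set R := ((t : ℝ) - 1) * (t - 2) / (2 * t) with hR
  set q := ∑ v ∈ Sᶜ, x v * (L - a v) with hq
  have hx0 := hx.1.1
  have hq0 : 0 ≤ q := sum_nonneg fun v hv => by
    rcases (hx0 v).eq_or_lt with h | h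
    · rw [← h, zero_mul]
    · exact mul_nonneg h.le (sub_nonneg.2 (Nat.cast_le.2 (hlight v hv h)))
  have hgain : ∑ v ∈ Sᶜ, x v * ∑ P ∈ pairLink E S v, ∑ i ∈ P, x i ≤
      R - ((t : ℝ) - 2) * weight (powersetCard 2 S) x - 2 * μ * q := by
    have h1 : ∑ v ∈ Sᶜ, x v * (y * ∑ P ∈ pairLink E S v, ∑ i ∈ P, x i +
        2 * μ * y * (L - a v)) ≤
        ∑ v ∈ Sᶜ, x v * (R - ((t : ℝ) - 2) * weight (powersetCard 2 S) x) := by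
      refine sum_le_sum fun v hv => ?_
      rcases (hx0 v).eq_or_lt with h | h
      · rw [← h, zero_mul, zero_mul]
      · exact mul_le_mul_of_nonneg_left
          (link_pairs_le hS ht hμ hy.le (filter_subset _ _) (hlight v hv h)) h.le
    rw [← sum_mul, hysum] at h1
    have h2 : ∑ v ∈ Sᶜ, x v * (y * ∑ P ∈ pairLink E S v, ∑ i ∈ P, x i +
        2 * μ * y * (L - a v)) =
        y * (∑ v ∈ Sᶜ, x v * ∑ P ∈ pairLink E S v, ∑ i ∈ P, x i + 2 * μ * q) := by
      rw [hq, mul_add, mul_sum, mul_sum, mul_sum, ← sum_add_distrib]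
      exact sum_congr rfl fun v _ => by ring
    rw [h2] at h1
    linarith [le_of_mul_le_mul_left h1 hy]
  have hloss : p * (3 * μ ^ 2) ≤ ∑ e ∈ powersetCard 3 S \ E, score S x e := by
    rw [hp, ← nsmul_eq_mul]
    exact card_nsmul_le_sum _ _ _ fun e he =>
      three_mul_sq_le_score (mem_sdiff.1 he).1 hμ hμ0
  set κ := min μ y with hκ
  have hκ0 : 0 ≤ κ := le_min hμ0 hy.le
  have houty : ∀ v, v ∉ S → x v ≤ y := fun v hv => by
    rw [← hysum]
    exact single_le_sum (fun i _ => hx0 i) (mem_compl.2 hv)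
  have hctype : ∑ e ∈ E with (e ∩ S).card ≤ 1, score S x e ≤ c * (μ * κ) := by
    rw [hcdef, ← nsmul_eq_mul]
    refine sum_le_card_nsmul _ _ _ fun e he => ?_
    have he' := mem_filter.1 he
    exact score_le_of_card_inter_le_one (hE e he'.1) he'.2 hx0 hout
      (fun v hv => le_min (hout v hv) (houty v hv)) hμ0 hκ0
  have hsuma : ∀ v ∈ Sᶜ, a v ≤ ∑ v ∈ Sᶜ, a v := fun v hv =>
    single_le_sum (fun i _ => by positivity) hv
  have hcle : c ≤ p + (L - ∑ v ∈ Sᶜ, a v) := by linarith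
  have hcharge : (L - ∑ v ∈ Sᶜ, a v) * κ ≤ q := by
    rcases le_total 0 (L - ∑ v ∈ Sᶜ, a v) with h | h
    · refine (mul_le_mul_of_nonneg_left (min_le_right _ _) h).trans ?_
      rw [← hysum, mul_comm, sum_mul]
      exact sum_le_sum fun v hv => mul_le_mul_of_nonneg_left (by linarith [hsuma v hv]) (hx0 v)
    · exact (mul_nonpos_of_nonpos_of_nonneg h hκ0).trans hq0
  have hp0 : 0 ≤ p := by positivity
  have h1 : c * (μ * κ) ≤ p * μ ^ 2 + μ * q := by
    have h2 : c * κ ≤ p * μ + q := by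
      have := mul_le_mul_of_nonneg_right hcle hκ0
      have h3 : p * κ ≤ p * μ := mul_le_mul_of_nonneg_left (min_le_left _ _) hp0
      linarith
    nlinarith [mul_le_mul_of_nonneg_left h2 hμ0]
  linarith

lemma exists_disjoint_subfamilies {ι β : Type*} [DecidableEq ι] [DecidableEq β] (s : Finset ι)
    (n : ι → ℕ) (M : Finset β) (h : ∑ i ∈ s, n i ≤ M.card) :
    ∃ g : ι → Finset β, (∀ i ∈ s, g i ⊆ M ∧ (g i).card = n i) ∧
      (s : Set ι).PairwiseDisjoint g := by
  induction s using Finset.induction_on generalizing M with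
  | empty => exact ⟨fun _ => ∅, by simp, by simp⟩
  | insert a s ha ih =>
    rw [sum_insert ha] at h
    obtain ⟨A, hA, hAc⟩ := exists_subset_card_eq (s := M) (n := n a) (by omega)
    obtain ⟨g, hg, hdisj⟩ := ih (M \ A) (by rw [card_sdiff_of_subset hA]; omega)
    have hga : ∀ i ∈ s, i ≠ a := fun i hi hia => ha (hia ▸ hi)
    refine ⟨Function.update g a A, fun i hi => ?_, ?_⟩
    · rcases mem_insert.1 hi with rfl | hi
      · simpa using ⟨hA, hAc⟩
      · rw [Function.update_of_ne (hga i hi)]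
        exact ⟨(hg i hi).1.trans sdiff_subset, (hg i hi).2⟩
    · rw [coe_insert, Set.pairwiseDisjoint_insert_of_notMem (by simpa using ha)]
      refine ⟨fun i hi j hj hij => ?_, fun j hj => ?_⟩
      · simp only [Function.onFun]
        rw [Function.update_of_ne (hga i hi), Function.update_of_ne (hga j hj)]
        exact hdisj hi hj hij
      · rw [Function.update_self, Function.update_of_ne (hga j hj)]
        exact disjoint_of_subset_right (hg j hj).1 disjoint_sdiff

/-- If some outer vertex of positive weight has more than `(t-1 choose 2)` pairs in its link, then
so many triples of `S` are missing that they pay for all these links. -/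
lemma sum_link_lt_of_heavy [Fintype α] {E : Finset (Finset α)} (hE : ∀ e ∈ E, e.card = 3)
    {S : Finset α} {t : ℕ} (hS : S.card = t) (ht : 3 ≤ t) {x : α → ℝ}
    (hx : x ∈ weightings (Set.univ : Set α))
    {μ : ℝ} (hμ0 : 0 < μ) (hμ : ∀ i ∈ S, μ ≤ x i) (hout : ∀ v, v ∉ S → x v ≤ μ)
    (hheavy : ∃ v ∈ Sᶜ, 0 < x v ∧ (t - 1).choose 2 < (pairLink E S v).card)
    (hcard : (E.card : ℝ) ≤ t.choose 3 + (t - 1).choose 2 - (t : ℝ) / 2) :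
    ∑ i ∈ S, link E x i < ((t : ℝ) - 1) * (t - 2) / (2 * t) := by
  set y := 1 - ∑ i ∈ S, x i with hydef
  have hysum : ∑ v ∈ Sᶜ, x v = y := sum_compl_eq hx S
  have hx0 := hx.1.1
  set B := Sᶜ.filter fun v => 0 < x v ∧ (t - 1).choose 2 < (pairLink E S v).card with hB
  have hBne : B.Nonempty := by
    obtain ⟨v, hv, h⟩ := hheavy
    exact ⟨v, mem_filter.2 ⟨hv, h⟩⟩
  have hBS : B ⊆ Sᶜ := filter_subset _ _
  have hxB : 0 < ∑ v ∈ B, x v := sum_pos (fun v hv => (mem_filter.1 hv).2.1) hBne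
  have hy : 0 < y := by
    rw [← hysum]
    exact hxB.trans_le (sum_le_sum_of_subset_of_nonneg hBS fun i _ _ => hx0 i)
  have hT := sum_link_triples hE S x
  have hc := card_triples hE S
  rw [hS] at hT hc
  set L : ℕ := (t - 1).choose 2 with hL
  have hL1 : 1 ≤ L := Nat.choose_pos (by omega)
  set M := powersetCard 3 S \ E with hM
  have hMS : M ⊆ powersetCard 3 S := sdiff_subset
  set h : α → ℕ := fun v => (pairLink E S v).card - L with hh
  have hhcard : ∀ v ∈ B, (pairLink E S v).card = L + h v := fun v hv => by
    have := (mem_filter.1 hv).2.2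
    simp only [hh]
    omega
  have hh1 : ∀ v ∈ B, 1 ≤ h v := fun v hv => by
    have := (mem_filter.1 hv).2.2
    simp only [hh]
    omega
  set c := (E.filter fun e => (e ∩ S).card ≤ 1).card with hcdef
  have ht' : (3 : ℝ) ≤ t := by exact_mod_cast ht
  -- Every heavy vertex `v` is to be given `h v + 1` missing triples of its own, the least number
  -- for which `exists_selection` works. The spare `t / 2` edges pay for the first of the extra
  -- triples and `1 ≤ L` pays for the others; as many further triples are missing as there are
  -- edges with at most one point in `S`.
  have hcount : ∑ v ∈ B, (h v + 1) + c ≤ M.card := by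
    have h1 : ∑ v ∈ B, ((L : ℝ) + h v) ≤ ∑ v ∈ Sᶜ, ((pairLink E S v).card : ℝ) := by
      refine le_trans (le_of_eq ?_)
        (sum_le_sum_of_subset_of_nonneg hBS fun i _ _ => by positivity)
      exact sum_congr rfl fun v hv => by rw [hhcard v hv]; push_cast; rfl
    rw [sum_add_distrib, sum_const, nsmul_eq_mul] at h1
    have h2 : (1 : ℝ) ≤ B.card := by exact_mod_cast hBne.card_pos
    have h3 : (1 : ℝ) ≤ L := by exact_mod_cast hL1
    have h4 : ((∑ v ∈ B, (h v + 1) + c : ℕ) : ℝ) ≤ M.card := by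
      push_cast
      rw [sum_add_distrib, sum_const, nsmul_eq_mul, mul_one]
      nlinarith [mul_nonneg (sub_nonneg.2 h2) (sub_nonneg.2 h3)]
    exact_mod_cast h4
  obtain ⟨g, hg, hdisj⟩ := exists_disjoint_subfamilies B (fun v => h v + 1) M (by omega)
  set R := ((t : ℝ) - 1) * (t - 2) / (2 * t) with hR
  set w := ((t : ℝ) - 2) * weight (powersetCard 2 S) x with hw
  have hgain : ∑ v ∈ Sᶜ, x v * ∑ P ∈ pairLink E S v, ∑ i ∈ P, x i ≤
      R - w + ∑ v ∈ B, x v * (∑ e ∈ g v, ∑ i ∈ e, x i - μ) := by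
    have h1 : ∑ v ∈ Sᶜ, x v * (y * ∑ P ∈ pairLink E S v, ∑ i ∈ P, x i) ≤
        ∑ v ∈ Sᶜ, x v * (R - w + if v ∈ B then y * (∑ e ∈ g v, ∑ i ∈ e, x i - μ) else 0) := by
      refine sum_le_sum fun v hv => ?_
      by_cases hvB : v ∈ B
      · rw [if_pos hvB]
        refine mul_le_mul_of_nonneg_left ?_ (hx0 v)
        have := link_pairs_le_add hS ht hμ hy.le (A := pairLink E S v) (filter_subset _ _)
          (hh1 v hvB) (hhcard v hvB) ((hg v hvB).1.trans hMS) (hg v hvB).2.ge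
        rw [(hg v hvB).2] at this
        push_cast at this
        have h2 : y * μ ≤ y * ((3 * ((h v : ℝ) + 1) - 2 * h v) * μ) := by
          refine mul_le_mul_of_nonneg_left ?_ hy.le
          have : (0 : ℝ) ≤ h v := by positivity
          nlinarith
        rw [mul_sub]
        linarith
      · rw [if_neg hvB, add_zero]
        rcases (hx0 v).eq_or_lt with h0 | h0
        · rw [← h0, zero_mul, zero_mul]
        · refine mul_le_mul_of_nonneg_left ?_ h0.le
          have hle : (pairLink E S v).card ≤ L := by
            by_contra! hlt
            exact hvB (mem_filter.2 ⟨hv, h0, hlt⟩)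
          have := link_pairs_le hS ht hμ hy.le (A := pairLink E S v) (filter_subset _ _) hle
          have h2 : 0 ≤ 2 * μ * y * ((L : ℝ) - (pairLink E S v).card) :=
            mul_nonneg (by positivity) (sub_nonneg.2 (by exact_mod_cast hle))
          linarith
    simp only [mul_add, mul_ite, mul_zero, sum_add_distrib] at h1
    rw [← sum_mul, hysum, sum_ite_mem, inter_eq_right.2 hBS] at h1
    have h3 : ∀ s : Finset α, ∀ f : α → ℝ, ∑ v ∈ s, x v * (y * f v) = y * ∑ v ∈ s, x v * f v :=
      fun s f => by
        rw [mul_sum]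
        exact sum_congr rfl fun v _ => by ring
    rw [h3, h3, ← mul_add] at h1
    exact le_of_mul_le_mul_left h1 hy
  have hloss : ∑ v ∈ B, x v * ∑ e ∈ g v, ∑ i ∈ e, x i + c * μ ^ 2 ≤ ∑ e ∈ M, score S x e := by
    have hU : B.biUnion g ⊆ M := biUnion_subset.2 fun v hv => (hg v hv).1
    rw [← sum_sdiff hU, sum_biUnion hdisj, add_comm]
    refine add_le_add ?_ (sum_le_sum fun v hv => ?_)
    · have hcr : (c : ℝ) ≤ ((M \ B.biUnion g).card : ℝ) := by
        have : c ≤ (M \ B.biUnion g).card := by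
          rw [card_sdiff_of_subset hU, card_biUnion hdisj,
            sum_congr rfl fun v hv => (hg v hv).2]
          omega
        exact_mod_cast this
      have h1 : ((M \ B.biUnion g).card : ℝ) * (3 * μ ^ 2) ≤
          ∑ e ∈ M \ B.biUnion g, score S x e := by
        rw [← nsmul_eq_mul]
        exact card_nsmul_le_sum _ _ _ fun e he =>
          three_mul_sq_le_score (hMS (mem_sdiff.1 he).1) hμ hμ0.le
      nlinarith [mul_le_mul_of_nonneg_right hcr (sq_nonneg μ), sq_nonneg μ]
    · rw [mul_sum]
      refine sum_le_sum fun e he => ?_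
      refine mul_sum_le_score (hMS ((hg v hv).1 he)) (fun i hi => ?_) (hx0 v)
      exact (hout v (mem_compl.1 (hBS hv))).trans (hμ i hi)
  have hctype : ∑ e ∈ E with (e ∩ S).card ≤ 1, score S x e ≤ c * μ ^ 2 := by
    rw [hcdef, ← nsmul_eq_mul]
    refine sum_le_card_nsmul _ _ _ fun e he => ?_
    have he' := mem_filter.1 he
    rw [sq]
    exact score_le_of_card_inter_le_one (hE e he'.1) he'.2 hx0 hout hout hμ0.le hμ0.le
  simp only [mul_sub, sum_sub_distrib] at hgain
  rw [← sum_mul] at hgain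
  have := mul_pos hxB hμ0
  linarith

end Triples

/-! ### Compressions -/

section Compression

variable [DecidableEq α]

open UV FinsetFamily in
lemma weight_le_weight_compression (E : Finset (Finset α)) {x : α → ℝ} (hx : ∀ i, 0 ≤ x i)
    {i v : α} (hiv : x i ≤ x v) : weight E x ≤ weight (𝓒 {v} {i} E) x := by
  have hprod : ∀ e : Finset α, ∏ k ∈ e, x k ≤ ∏ k ∈ compress {v} {i} e, x k := by
    intro e
    unfold compress
    split_ifs with h
    · obtain ⟨hv, hi⟩ := h
      rw [disjoint_singleton_left] at hv
      have hi : i ∈ e := singleton_subset_iff.1 hi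
      have hvi : v ≠ i := fun h => hv (h ▸ hi)
      have : (e ⊔ {v}) \ {i} = insert v (e.erase i) := by
        ext k
        simp only [sup_eq_union, mem_sdiff, mem_union, mem_singleton, mem_insert, mem_erase]
        grind
      rw [this, prod_insert (fun h => hv (mem_of_mem_erase h)), ← mul_prod_erase e x hi]
      exact mul_le_mul_of_nonneg_right hiv (prod_nonneg fun k _ => hx k)
    · exact le_rfl
  unfold weight compression
  rw [sum_union compress_disjoint,
    ← sum_filter_add_sum_filter_not E (fun e => compress {v} {i} e ∈ E)]
  refine add_le_add le_rfl ?_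
  rw [filter_image, sum_image (fun a ha b hb h => compress_injOn ha hb h)]
  exact sum_le_sum fun e _ => hprod e

open UV FinsetFamily in
lemma powersetCard_subset_compression {E : Finset (Finset α)} {S : Finset α} {r : ℕ}
    (hS : powersetCard r S ⊆ E) {i v : α} (hi : i ∈ S) (hv : v ∉ S) :
    powersetCard r (insert v (S.erase i)) ⊆ 𝓒 {v} {i} E := by
  intro e he
  obtain ⟨heS, hec⟩ := mem_powersetCard.1 he
  have hvi : v ≠ i := fun h => hv (h ▸ hi)
  have hie : i ∉ e := fun h => by
    rcases mem_insert.1 (heS h) with h | h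
    · exact hvi h.symm
    · exact (mem_erase.1 h).1 rfl
  have hself : compress {v} {i} e = e := by
    unfold compress
    rw [if_neg]
    rintro ⟨-, h⟩
    exact hie (singleton_subset_iff.1 h)
  rw [mem_compression]
  by_cases heE : e ∈ E
  · exact Or.inl ⟨heE, by rwa [hself]⟩
  · refine Or.inr ⟨heE, ?_⟩
    have hve : v ∈ e := by
      by_contra hve
      refine heE (hS (mem_powersetCard.2 ⟨fun k hk => ?_, hec⟩))
      rcases mem_insert.1 (heS hk) with rfl | h
      · exact absurd hk hve
      · exact mem_of_mem_erase h
    have hie' : i ∉ e.erase v := fun h => hie (mem_of_mem_erase h)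
    refine ⟨insert i (e.erase v), hS (mem_powersetCard.2 ⟨fun k hk => ?_, ?_⟩), ?_⟩
    · rcases mem_insert.1 hk with rfl | h
      · exact hi
      · obtain ⟨hkv, hke⟩ := mem_erase.1 h
        rcases mem_insert.1 (heS hke) with h | h
        · exact absurd h hkv
        · exact mem_of_mem_erase h
    · rw [card_insert_of_notMem hie', card_erase_add_one hve, hec]
    · unfold compress
      rw [if_pos]
      · ext k
        simp only [sup_eq_union, mem_sdiff, mem_union, mem_singleton, mem_insert, mem_erase]
        grind
      · refine ⟨?_, singleton_subset_iff.2 (mem_insert_self _ _)⟩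
        rw [disjoint_singleton_left]
        simp [hvi]

end Compression

/-! ### Lagrangians of 3-graphs with few edges -/

section ThreeGraphs

lemma cast_choose_three (n : ℕ) : (n.choose 3 : ℝ) = n * (n - 1) * (n - 2) / 6 := by
  induction n with
  | zero => simp
  | succ n ih =>
    rw [Nat.choose_succ_succ]
    push_cast
    rw [ih, Nat.cast_choose_two]
    ring

lemma three_mul_choose_three {t : ℕ} (ht : 3 ≤ t) :
    ((t : ℝ) - 1) * (t - 2) / (2 * t) = t * (3 * (t.choose 3 * (1 / (t : ℝ)) ^ 3)) := by
  have : (0 : ℝ) < t := by exact_mod_cast (by omega : 0 < t)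
  rw [cast_choose_three]
  field_simp
  ring

/-- The Lagrangians of the complete `3`-graphs are strictly increasing. -/
lemma choose_three_mul_lt {n t : ℕ} (hn : 1 ≤ n) (hnt : n < t) (ht : 3 ≤ t) :
    n.choose 3 * (1 / (n : ℝ)) ^ 3 < t.choose 3 * (1 / (t : ℝ)) ^ 3 := by
  have h : ∀ k : ℕ, 1 ≤ k → k.choose 3 * (1 / (k : ℝ)) ^ 3 =
      (1 - 3 * (1 / (k : ℝ)) + 2 * (1 / (k : ℝ)) ^ 2) / 6 := by
    intro k hk
    have : (0 : ℝ) < k := by exact_mod_cast hk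
    rw [cast_choose_three]
    field_simp
    ring
  rw [h n hn, h t (by omega)]
  have hn0 : (0 : ℝ) < n := by exact_mod_cast hn
  have h1 : 1 / (t : ℝ) < 1 / n := one_div_lt_one_div_of_lt hn0 (by exact_mod_cast hnt)
  have h2 : 1 / (n : ℝ) ≤ 1 := by
    rw [div_le_one hn0]
    exact_mod_cast hn
  have h3 : 1 / (t : ℝ) ≤ 1 / 3 :=
    one_div_le_one_div_of_le (by norm_num) (by exact_mod_cast ht)
  nlinarith [mul_pos (sub_pos.2 h1) (show 0 < 3 - 2 * (1 / (n : ℝ) + 1 / t) by linarith)]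

variable [Fintype α]

lemma weight_eq_weight_filter_subset [DecidableEq α] (E : Finset (Finset α)) {W : Finset α}
    {x : α → ℝ} (hx : x ∈ weightings (W : Set α)) :
    weight E x = weight (E.filter fun e => e ⊆ W) x := by
  unfold weight
  symm
  refine sum_subset (filter_subset _ _) fun e he hne => ?_
  have : ¬ e ⊆ W := fun h => hne (mem_filter.2 ⟨he, h⟩)
  obtain ⟨i, hi, hiW⟩ := not_subset.1 this
  exact prod_eq_zero hi (hx.2 i (by simpa using hiW))

lemma weight_le_of_mem_weightings {E : Finset (Finset α)} {r : ℕ} (hE : ∀ e ∈ E, e.card = r)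
    {W : Finset α} {x : α → ℝ} (hx : x ∈ weightings (W : Set α)) :
    weight E x ≤ weight (powersetCard r W) x := by
  classical
  rw [weight_eq_weight_filter_subset E hx]
  refine weight_mono hx.1.1 fun e he => ?_
  have := mem_filter.1 he
  exact mem_powersetCard.2 ⟨this.2, hE e this.1⟩

lemma mem_weightings_support {V : Set α} {x : α → ℝ} (hx : x ∈ weightings V) :
    x ∈ weightings ((univ.filter fun i => 0 < x i : Finset α) : Set α) := by
  refine ⟨hx.1, fun i hi => ?_⟩
  simp only [coe_filter, mem_univ, true_and, Set.mem_ofPred_eq, not_lt] at hi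
  exact hi.antisymm (hx.1.1 i)

/-- A weighting on at most `t` vertices that reaches the Lagrangian of the complete `3`-graph on
`t` vertices is supported on a complete subgraph of order `t`. -/
lemma complete_of_card_support_le {E : Finset (Finset α)} (hE : ∀ e ∈ E, e.card = 3) {t : ℕ}
    (ht : 3 ≤ t) {x : α → ℝ} (hx : x ∈ weightings (Set.univ : Set α))
    (hW : (univ.filter fun i => 0 < x i).card ≤ t)
    (hge : t.choose 3 * (1 / (t : ℝ)) ^ 3 ≤ weight E x) :
    (univ.filter fun i => 0 < x i).card = t ∧
      powersetCard 3 (univ.filter fun i => 0 < x i) ⊆ E ∧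
      weight E x ≤ t.choose 3 * (1 / (t : ℝ)) ^ 3 := by
  classical
  set W := univ.filter fun i => 0 < x i with hWdef
  have hxW : x ∈ weightings (W : Set α) := mem_weightings_support hx
  have hle := weight_le_of_mem_weightings hE hxW
  have hmac := weight_powersetCard_le (r := 3) (by norm_num) hxW
  have hWne : 1 ≤ W.card := by
    rw [Nat.one_le_iff_ne_zero]
    intro h
    have := sum_eq_one_of_mem_weightings hxW
    rw [card_eq_zero.1 h, sum_empty] at this
    exact zero_ne_one this
  have hcard : W.card = t := by
    by_contra hne
    have := choose_three_mul_lt hWne (lt_of_le_of_ne hW hne) ht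
    linarith
  rw [hcard] at hmac
  refine ⟨hcard, fun e he => ?_, by linarith⟩
  by_contra hne
  have h1 : weight E x ≤ weight ((powersetCard 3 W).erase e) x := by
    rw [weight_eq_weight_filter_subset E hxW]
    refine weight_mono hx.1.1 fun f hf => ?_
    have := mem_filter.1 hf
    rw [mem_erase, mem_powersetCard]
    exact ⟨fun hfe => hne (hfe ▸ this.1), this.2, hE f this.1⟩
  have h3 : weight ((powersetCard 3 W).erase e) x + ∏ i ∈ e, x i =
      weight (powersetCard 3 W) x := sum_erase_add _ _ he
  have h4 : 0 < ∏ i ∈ e, x i := prod_pos fun i hi =>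
    (mem_filter.1 ((mem_powersetCard.1 he).1 hi)).2
  linarith

variable [DecidableEq α]

lemma exists_top_set (x : α → ℝ) {t : ℕ} (ht : t ≤ Fintype.card α) :
    ∃ S : Finset α, S.card = t ∧ ∀ i ∈ S, ∀ v, v ∉ S → x v ≤ x i := by
  obtain ⟨S, hS, hmax⟩ := exists_max_image (powersetCard t (univ : Finset α))
    (fun S => ∑ i ∈ S, x i) (powersetCard_nonempty.2 (by simpa using ht))
  have hSc := (mem_powersetCard.1 hS).2
  refine ⟨S, hSc, fun i hi v hv => ?_⟩
  have hv' : v ∉ S.erase i := fun h => hv (mem_of_mem_erase h)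
  have := hmax (insert v (S.erase i)) (by
    rw [mem_powersetCard]
    exact ⟨subset_univ _, by rw [card_insert_of_notMem hv', card_erase_add_one hi, hSc]⟩)
  rw [sum_insert hv', ← add_sum_erase S x hi] at this
  linarith

/-- With at most `(t choose 3) + (t-1 choose 2) - t / 2` edges, an optimal weighting that reaches
the Lagrangian of the complete `3`-graph on `t` vertices has at most `t` vertices in its support:
otherwise the average of the links over the `t` largest weights would be too small. -/
lemma card_support_le {E : Finset (Finset α)} (hE : ∀ e ∈ E, e.card = 3) {t : ℕ} (ht : 3 ≤ t)
    (hcard : (E.card : ℝ) ≤ t.choose 3 + (t - 1).choose 2 - (t : ℝ) / 2) {x : α → ℝ}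
    (hx : x ∈ weightings (Set.univ : Set α))
    (hmax : ∀ z ∈ weightings (Set.univ : Set α), weight E z ≤ weight E x)
    (hge : t.choose 3 * (1 / (t : ℝ)) ^ 3 ≤ weight E x) :
    (univ.filter fun i => 0 < x i).card ≤ t := by
  by_contra! hlt
  obtain ⟨S, hS, htop⟩ := exists_top_set x (hlt.le.trans (card_le_univ _))
  have ht0 : (3 : ℝ) ≤ t := by exact_mod_cast ht
  obtain ⟨v, hv, hvS⟩ : ∃ v, 0 < x v ∧ v ∉ S := by
    by_contra! h
    have := card_le_card (fun i hi => h i (mem_filter.1 hi).2 :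
      (univ.filter fun i => 0 < x i) ⊆ S)
    omega
  obtain ⟨b, hb, hbmin⟩ := exists_min_image S x (card_pos.1 (by omega))
  have hb0 : 0 < x b := hv.trans_le (htop b hb v hvS)
  have hy : 0 < 1 - ∑ i ∈ S, x i := by
    rw [← sum_compl_eq hx S]
    exact hv.trans_le (single_le_sum (f := x) (fun i _ => hx.1.1 i) (mem_compl.2 hvS))
  have hT : ((t : ℝ) - 1) * (t - 2) / (2 * t) ≤ ∑ i ∈ S, link E x i := by
    rw [sum_congr rfl fun i hi => link_eq_of_isMax hE hx hmax (hb0.trans_le (hbmin i hi)),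
      sum_const, hS, nsmul_eq_mul, three_mul_choose_three ht]
    push_cast
    gcongr
  have hout : ∀ v, v ∉ S → x v ≤ x b := fun v hv => htop b hb v hv
  by_cases hheavy : ∃ v ∈ Sᶜ, 0 < x v ∧ (t - 1).choose 2 < (pairLink E S v).card
  · exact absurd hT (not_le.2 (sum_link_lt_of_heavy hE hS ht hx hb0 hbmin hout hheavy hcard))
  · push Not at hheavy
    have hle := sum_link_le_of_light hE hS ht hx hb0.le hbmin hout hy hheavy (by linarith)
    set q := ∑ v ∈ Sᶜ, x v * (((t - 1).choose 2 : ℝ) - (pairLink E S v).card) with hq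
    have hq0 : 0 ≤ q := sum_nonneg fun v hv => by
      rcases (hx.1.1 v).eq_or_lt with h | h
      · rw [← h, zero_mul]
      · exact mul_nonneg h.le (sub_nonneg.2 (Nat.cast_le.2 (hheavy v hv h)))
    rcases Nat.eq_zero_or_pos (powersetCard 3 S \ E).card with hp | hp
    · have hc := card_triples hE S
      rw [hp, hS] at hc
      have h1 : ∑ v ∈ Sᶜ, x v * ((t : ℝ) / 2) ≤ q := by
        refine sum_le_sum fun v hv => mul_le_mul_of_nonneg_left ?_ (hx.1.1 v)
        have h2 : ((pairLink E S v).card : ℝ) ≤ ∑ v ∈ Sᶜ, ((pairLink E S v).card : ℝ) :=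
          single_le_sum (f := fun v => ((pairLink E S v).card : ℝ))
            (fun i _ => by positivity) hv
        have h3 : (0 : ℝ) ≤ ((E.filter fun e => (e ∩ S).card ≤ 1).card : ℝ) := by positivity
        push_cast at hc
        linarith
      rw [← sum_mul, sum_compl_eq hx] at h1
      have h4 : 0 < q := (mul_pos hy (by linarith)).trans_le h1
      have := mul_pos hb0 h4
      rw [hp] at hle
      push_cast at hle
      linarith
    · have h1 : 0 < 2 * ((powersetCard 3 S \ E).card : ℝ) * x b ^ 2 := by positivity
      have := mul_nonneg hb0.le hq0
      linarith

/-- A `3`-graph with at most `(t choose 3) + (t-1 choose 2) - t / 2` edges reaches the Lagrangian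
of the complete `3`-graph on `t` vertices only on a complete subgraph of order `t`, and does not
exceed it. -/
lemma complete_of_choose_three_le {E : Finset (Finset α)} (hE : ∀ e ∈ E, e.card = 3) {t : ℕ}
    (ht : 3 ≤ t) (hcard : (E.card : ℝ) ≤ t.choose 3 + (t - 1).choose 2 - (t : ℝ) / 2)
    {x : α → ℝ} (hx : x ∈ weightings (Set.univ : Set α))
    (hge : t.choose 3 * (1 / (t : ℝ)) ^ 3 ≤ weight E x) :
    (univ.filter fun i => 0 < x i).card = t ∧
      powersetCard 3 (univ.filter fun i => 0 < x i) ⊆ E ∧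
      weight E x ≤ t.choose 3 * (1 / (t : ℝ)) ^ 3 := by
  have hne : (Set.univ : Set α).Nonempty := by
    by_contra h
    rw [Set.not_nonempty_iff_eq_empty, Set.univ_eq_empty_iff] at h
    have := hx.1.2
    rw [univ_eq_empty, sum_empty] at this
    exact zero_ne_one this
  obtain ⟨z, hz, hzmax⟩ := exists_isMax_weight E hne
  have hzge := hge.trans (hzmax x hx)
  have hzle := (complete_of_card_support_le hE ht hz
    (card_support_le hE ht hcard hz hzmax hzge) hzge).2.2
  refine complete_of_card_support_le hE ht hx (card_support_le hE ht hcard hx (fun w hw => ?_)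
    hge) hge
  exact (hzmax w hw).trans (hzle.trans hge)

open UV FinsetFamily in
/-- A `3`-graph with at most `(t choose 3) + (t-1 choose 2)` edges and a complete subgraph of
order `t` has the Lagrangian of that subgraph. In an extremal configuration, compressions move the
complete subgraph to the largest weights; there the average of its links is controlled. -/
lemma weight_le_of_complete {E : Finset (Finset α)} (hE : ∀ e ∈ E, e.card = 3) {t : ℕ}
    (ht : 3 ≤ t) (hcard : E.card ≤ t.choose 3 + (t - 1).choose 2) {S : Finset α}
    (hS : S.card = t) (hSE : powersetCard 3 S ⊆ E) {x : α → ℝ}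
    (hx : x ∈ weightings (Set.univ : Set α)) :
    weight E x ≤ t.choose 3 * (1 / (t : ℝ)) ^ 3 := by
  let P : Finset (Finset α) → Finset α → Prop := fun F U =>
    ((∀ e ∈ F, e.card = 3) ∧ F.card ≤ t.choose 3 + (t - 1).choose 2) ∧
      U.card = t ∧ powersetCard 3 U ⊆ F
  have hne : (Set.univ : Set α).Nonempty := by
    obtain ⟨i, -⟩ := card_pos.1 (by omega : 0 < S.card)
    exact ⟨i, trivial⟩
  obtain ⟨E₁, z, ⟨U₁, hU₁⟩, hz, hext⟩ := exists_extremal (fun F => ∃ U, P F U)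
    ⟨E, S, ⟨hE, hcard⟩, hS, hSE⟩ hne
  refine (hext E x ⟨S, ⟨hE, hcard⟩, hS, hSE⟩ hx).trans ?_
  classical
  obtain ⟨⟨F, U⟩, hFU, hmax⟩ := exists_max_image
    ((univ : Finset (Finset (Finset α) × Finset α)).filter fun p =>
      P p.1 p.2 ∧ weight p.1 z = weight E₁ z) (fun p => ∑ i ∈ p.2, z i)
    ⟨(E₁, U₁), by simpa using hU₁⟩
  obtain ⟨⟨⟨hF, hFcard⟩, hU, hUF⟩, hFz⟩ := (mem_filter.1 hFU).2
  dsimp only at hF hFcard hU hUF hFz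
  have hz0 := hz.1.1
  have htop : ∀ i ∈ U, ∀ v, v ∉ U → z v ≤ z i := by
    intro i hi v hv
    by_contra! hlt
    have hv' : v ∉ U.erase i := fun h => hv (mem_of_mem_erase h)
    have hP : P (𝓒 {v} {i} F) (insert v (U.erase i)) := by
      refine ⟨⟨?_, ?_⟩, ?_, ?_⟩
      · have : (F : Set (Finset α)).Sized 3 := fun e he => hF e he
        exact fun e he => this.uvCompression (by simp) he
      · rwa [card_compression]
      · rw [card_insert_of_notMem hv', card_erase_add_one hi, hU]
      · exact powersetCard_subset_compression hUF hi hv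
    have hw : weight (𝓒 {v} {i} F) z = weight E₁ z := by
      refine (hext _ z ⟨_, hP⟩ hz).antisymm ?_
      rw [← hFz]
      exact weight_le_weight_compression F hz0 hlt.le
    have := hmax (𝓒 {v} {i} F, insert v (U.erase i)) (by simpa using ⟨hP, hw⟩)
    dsimp only at this
    rw [sum_insert hv', ← add_sum_erase U z hi] at this
    linarith
  rw [← hFz]
  have hFmax : ∀ w ∈ weightings (Set.univ : Set α), weight F w ≤ weight F z := fun w hw => by
    rw [hFz]
    exact hext F w ⟨U, ⟨hF, hFcard⟩, hU, hUF⟩ hw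
  have hysum := sum_compl_eq hz U
  rcases (sum_nonneg fun i _ => hz0 i : 0 ≤ ∑ v ∈ Uᶜ, z v).eq_or_lt with hy | hy
  · -- The weighting lives on the complete subgraph.
    have hzU : z ∈ weightings (U : Set α) := by
      refine ⟨hz.1, fun i hi => ?_⟩
      exact (sum_eq_zero_iff_of_nonneg fun i _ => hz0 i).1 hy.symm i
        (mem_compl.2 (by simpa using hi))
    have := weight_powersetCard_le (r := 3) (by norm_num) hzU
    rw [hU] at this
    exact (weight_le_of_mem_weightings hF hzU).trans this
  · obtain ⟨v, hvU, hv⟩ := exists_lt_of_sum_lt (by simpa using hy : ∑ v ∈ Uᶜ, (0 : ℝ) < _)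
    obtain ⟨b, hb, hbmin⟩ := exists_min_image U z (card_pos.1 (by omega))
    have hb0 : 0 < z b := hv.trans_le (htop b hb v (mem_compl.1 hvU))
    have hp : powersetCard 3 U \ F = ∅ := sdiff_eq_empty_iff_subset.2 hUF
    have hc := card_triples hF U
    rw [hp, hU] at hc
    have hFcard' : (F.card : ℝ) ≤ t.choose 3 + (t - 1).choose 2 := by exact_mod_cast hFcard
    have hlight : ∀ v ∈ Uᶜ, (pairLink F U v).card ≤ (t - 1).choose 2 := fun v hv => by
      have h2 : ((pairLink F U v).card : ℝ) ≤ ∑ v ∈ Uᶜ, ((pairLink F U v).card : ℝ) :=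
        single_le_sum (f := fun v => ((pairLink F U v).card : ℝ))
          (fun i _ => by positivity) hv
      have h3 : (0 : ℝ) ≤ ((F.filter fun e => (e ∩ U).card ≤ 1).card : ℝ) := by positivity
      rw [card_empty] at hc
      push_cast at hc
      have : ((pairLink F U v).card : ℝ) ≤ ((t - 1).choose 2 : ℝ) := by linarith
      exact_mod_cast this
    have hle := sum_link_le_of_light hF hU ht hz hb0.le hbmin
      (fun v hv => htop b hb v hv) (by rwa [← hysum]) (fun v hv _ => hlight v hv) hFcard'
    have hq0 : 0 ≤ ∑ v ∈ Uᶜ, z v * (((t - 1).choose 2 : ℝ) - (pairLink F U v).card) :=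
      sum_nonneg fun v hv =>
        mul_nonneg (hz0 v) (sub_nonneg.2 (Nat.cast_le.2 (hlight v hv)))
    rw [hp, card_empty, sum_congr rfl fun i hi =>
      link_eq_of_isMax hF hz hFmax (hb0.trans_le (hbmin i hi)), sum_const, hU, nsmul_eq_mul,
      three_mul_choose_three ht] at hle
    have ht0 : (0 : ℝ) < t := by exact_mod_cast (by omega : 0 < t)
    have h5 : (t : ℝ) * (3 * weight F z) ≤ t * (3 * (t.choose 3 * (1 / (t : ℝ)) ^ 3)) := by
      have := mul_nonneg hb0.le hq0
      push_cast at hle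
      linarith
    linarith [le_of_mul_le_mul_left h5 ht0]

end ThreeGraphs

/-! ### A numerical estimate -/

section NumericalEstimate

lemma pow_sub_one_le {β : ℝ} (h1 : 1 ≤ β) (h2 : β ≤ 2) (k : ℕ) :
    β ^ k - 1 ≤ (β - 1) * (2 ^ k - 1) := by
  induction k with
  | zero => simp
  | succ k ih =>
    have h3 : (0 : ℝ) ≤ 2 ^ k - 1 := sub_nonneg.2 (one_le_pow₀ (by norm_num))
    have h4 : β * (β ^ k - 1) ≤ 2 * ((β - 1) * (2 ^ k - 1)) :=
      mul_le_mul h2 ih (sub_nonneg.2 (one_le_pow₀ h1)) (by norm_num)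
    rw [pow_succ, pow_succ]
    nlinarith

/-- The estimate in `sub_le_of_choose`, with the powers cleared. -/
lemma choose_estimate {n k : ℕ} (hk : 2 ≤ k) (hn : k ≤ n)
    (hc : ((2 : ℝ) ^ (k - 1) - 1) * ((n + 1).choose k - 1) ≤ (n + 1).choose (k + 1))
    {β : ℝ} (h1 : 1 ≤ β) (h2 : β ≤ 2) :
    (n.choose k * ((2 - β) * β) + n.choose (k - 1)) * (β ^ k - 1) ≤
      β * ((2 ^ (k - 1) - 1) * (n.choose k + n.choose (k - 1) - 1)) := by
  obtain ⟨j, rfl⟩ : ∃ j, k = j + 2 := ⟨k - 2, by omega⟩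
  simp only [show j + 2 - 1 = j + 1 from rfl] at hc ⊢
  have hC : ((n + 1).choose (j + 2) : ℝ) = n.choose (j + 1) + n.choose (j + 2) := by
    rw [Nat.choose_succ_succ]
    push_cast
    rfl
  rcases Nat.eq_zero_or_pos j with rfl | hj
  · -- `k = 2`: the hypothesis forces `4 ≤ n`, and a quartic in `β` remains.
    have hn4 : 4 ≤ n := by
      by_contra! hlt
      interval_cases n <;> norm_num [Nat.choose] at hc
    have hn4' : (4 : ℝ) ≤ n := by exact_mod_cast hn4
    simp only [zero_add, Nat.choose_one_right, pow_one, Nat.cast_choose_two]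
    have h3 : 0 ≤ 3 - β - 2 * β ^ 2 + β ^ 3 := by
      nlinarith [sq_nonneg (β - 3 / 2), mul_nonneg (sub_nonneg.2 h1) (sub_nonneg.2 h2)]
    have h4 : β ≤ 4 * (3 / 2 * β * (3 - β - 2 * β ^ 2 + β ^ 3) - (β ^ 2 - 1 - β)) := by
      nlinarith [sq_nonneg (β ^ 2 - β - 6 / 5), mul_nonneg (sub_nonneg.2 h1) (sub_nonneg.2 h2)]
    have h5 : 0 ≤ ((n : ℝ) - 4) / 2 * (β * (3 - β - 2 * β ^ 2 + β ^ 3)) :=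
      mul_nonneg (by linarith) (mul_nonneg (by linarith) h3)
    have h6 : β ≤ n * (((n : ℝ) - 1) / 2 * (β * (3 - β - 2 * β ^ 2 + β ^ 3)) -
        (β ^ 2 - 1 - β)) := by
      have h7 : β ≤ 4 * (((n : ℝ) - 1) / 2 * (β * (3 - β - 2 * β ^ 2 + β ^ 3)) -
        (β ^ 2 - 1 - β)) := by linarith
      nlinarith
    nlinarith
  · have hpow : (4 : ℝ) ≤ 2 ^ (j + 1) := by
      have := pow_le_pow_right₀ (one_le_two (α := ℝ)) (show 2 ≤ j + 1 by omega)
      linarith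
    have hpow2 : (2 : ℝ) ^ (j + 2) = 2 * 2 ^ (j + 1) := pow_succ' _ _
    have hN : (4 : ℝ) ≤ (n + 1).choose (j + 2) := by
      have h : (j + 3).choose (j + 2) ≤ (n + 1).choose (j + 2) :=
        Nat.choose_le_choose _ (by omega)
      rw [Nat.choose_succ_self_right] at h
      exact_mod_cast (by omega : 4 ≤ (n + 1).choose (j + 2))
    have hC2 : (2 : ℝ) ≤ n.choose (j + 1) := by
      obtain ⟨m, rfl⟩ : ∃ m, n = m + 1 := ⟨n - 1, by omega⟩
      have h3 : 0 < m.choose j := Nat.choose_pos (by omega)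
      have h4 : 0 < m.choose (j + 1) := Nat.choose_pos (by omega)
      rw [Nat.choose_succ_succ]
      exact_mod_cast (by omega : 2 ≤ m.choose j + m.choose (j + 1))
    -- The hypothesis makes `n` large compared with `k`.
    have hratio : (9 : ℝ) / 4 * (j + 3) ≤ n - j - 1 := by
      have h3 := Nat.choose_succ_right_eq (n + 1) (j + 2)
      have h4 : (((n + 1).choose (j + 2 + 1) : ℕ) : ℝ) * (j + 3) =
          (n + 1).choose (j + 2) * (n - j - 1) := by
        have := congrArg (Nat.cast : ℕ → ℝ) h3
        rw [show n + 1 - (j + 2) = n - (j + 1) by omega] at this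
        push_cast [Nat.cast_sub (by omega : j + 1 ≤ n)] at this
        linarith
      have h5 : (3 : ℝ) * (3 / 4 * (n + 1).choose (j + 2)) ≤ (n + 1).choose (j + 2 + 1) := by
        refine le_trans ?_ hc
        refine mul_le_mul (by linarith) (by linarith) (by positivity) (by linarith)
      have h6 := mul_le_mul_of_nonneg_right h5 (by positivity : (0 : ℝ) ≤ (j : ℝ) + 3)
      rw [h4] at h6
      have h7 : ((n + 1).choose (j + 2) : ℝ) * (9 / 4 * (j + 3)) ≤
          (n + 1).choose (j + 2) * (n - j - 1) := by linarith
      exact le_of_mul_le_mul_left h7 (by linarith)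
    have hC1 : 2 * (n.choose (j + 1) : ℝ) ≤ n.choose (j + 2) := by
      have h3 := Nat.choose_succ_right_eq n (j + 1)
      have h4 : ((n.choose (j + 2) : ℕ) : ℝ) * (j + 2) = n.choose (j + 1) * (n - j - 1) := by
        have := congrArg (Nat.cast : ℕ → ℝ) h3
        push_cast [Nat.cast_sub (by omega : j + 1 ≤ n)] at this
        linarith
      have h5 := mul_le_mul_of_nonneg_left hratio (by linarith : (0 : ℝ) ≤ n.choose (j + 1))
      have hj0 : (0 : ℝ) ≤ j := by positivity
      nlinarith
    set C1 := (n.choose (j + 2) : ℝ)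
    set C2 := (n.choose (j + 1) : ℝ)
    set p : ℝ := 2 ^ (j + 1) with hp
    have h3 : (2 - β) * (β ^ (j + 2) - 1) ≤ (2 * p - 1) / 4 := by
      have h4 := pow_sub_one_le h1 h2 (j + 2)
      rw [hpow2] at h4
      have h5 := mul_le_mul_of_nonneg_left h4 (sub_nonneg.2 h2)
      have h6 : (2 - β) * (β - 1) ≤ 1 / 4 := by nlinarith [sq_nonneg (β - 3 / 2)]
      nlinarith [mul_le_mul_of_nonneg_right h6 (by linarith : (0 : ℝ) ≤ 2 * p - 1)]
    have h4 : β ^ (j + 2) - 1 ≤ β * (p - 1 / 2) := by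
      have h5 : β ^ (j + 1) ≤ p := pow_le_pow_left₀ (by linarith) h2 _
      have h6 : β ^ (j + 2) = β * β ^ (j + 1) := pow_succ' _ _
      rw [h6]
      nlinarith [mul_le_mul_of_nonneg_left h5 (by linarith : (0 : ℝ) ≤ β)]
    have h5 : C1 * ((2 * p - 1) / 4) + C2 * (p - 1 / 2) ≤ (p - 1) * (C1 + C2 - 1) := by
      nlinarith [mul_le_mul_of_nonneg_right hC1 (by linarith : (0 : ℝ) ≤ p / 2 - 3 / 4),
        mul_le_mul_of_nonneg_right hC2 (by linarith : (0 : ℝ) ≤ p - 2)]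
    have h6 : C1 * (β * ((2 - β) * (β ^ (j + 2) - 1))) ≤ C1 * (β * ((2 * p - 1) / 4)) :=
      mul_le_mul_of_nonneg_left (mul_le_mul_of_nonneg_left h3 (by linarith)) (by linarith)
    have h7 := mul_le_mul_of_nonneg_left h4 (by linarith : 0 ≤ C2)
    have h8 := mul_le_mul_of_nonneg_left h5 (by linarith : 0 ≤ β)
    linarith

/-- The numerical estimate behind the bound for `r`-graphs with one vertex outside a complete
subgraph, where `r = k + 2`. -/
lemma sub_le_of_choose {n k : ℕ} (hk : 2 ≤ k) (hn : k ≤ n)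
    (hc : ((2 : ℝ) ^ (k - 1) - 1) * ((n + 1).choose k - 1) ≤ (n + 1).choose (k + 1))
    {β Y a : ℝ} (h1 : 1 ≤ β) (h2 : β ≤ 2) (hYa : Y ≤ a * β ^ k)
    (hY : Y ≤ n.choose k * ((2 - β) * β ^ k) + n.choose (k - 1) * β ^ (k - 1)) :
    Y ≤ a + (2 ^ (k - 1) - 1) * (n.choose k + n.choose (k - 1) - 1) := by
  have hest := choose_estimate hk hn hc h1 h2
  set Q := ((2 : ℝ) ^ (k - 1) - 1) * (n.choose k + n.choose (k - 1) - 1) with hQ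
  have hβ0 : 0 < β := by linarith
  have hw : β ^ k = β ^ (k - 1) * β := by
    rw [← pow_succ]
    congr 1
    omega
  have hw1 : 1 ≤ β ^ k := one_le_pow₀ h1
  have hw0 : 0 < β ^ (k - 1) := by positivity
  have h3 : Y ≤ β ^ (k - 1) * (n.choose k * ((2 - β) * β) + n.choose (k - 1)) := by
    rw [hw] at hY
    linarith
  have h4 : Y * (β ^ k - 1) ≤ β ^ k * Q := by
    have := mul_le_mul_of_nonneg_right h3 (sub_nonneg.2 hw1)
    have h5 := mul_le_mul_of_nonneg_left hest hw0.le
    have h6 : β ^ k * Q = β ^ (k - 1) * (β * Q) := by rw [hw]; ring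
    linarith
  have h5 : β ^ k * Y ≤ β ^ k * (a + Q) := by linarith
  exact le_of_mul_le_mul_left h5 (by linarith)

end NumericalEstimate

/-! ### One vertex outside a complete subgraph -/

section OneOuterVertex

lemma weight_le_card_mul_pow {E : Finset (Finset α)} {k : ℕ} {S : Finset α}
    (hE : E ⊆ powersetCard k S) {x : α → ℝ} {c : ℝ} (hx : ∀ i, 0 ≤ x i)
    (hc : ∀ i ∈ S, x i ≤ c) : weight E x ≤ E.card * c ^ k := by
  rw [← nsmul_eq_mul]
  refine sum_le_card_nsmul _ _ _ fun e he => ?_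
  obtain ⟨h1, h2⟩ := mem_powersetCard.1 (hE he)
  rw [← h2, ← prod_const]
  exact prod_le_prod (fun i _ => hx i) fun i hi => hc i (h1 hi)

lemma card_mul_pow_le_weight {E : Finset (Finset α)} {k : ℕ} {S : Finset α}
    (hE : E ⊆ powersetCard k S) {x : α → ℝ} {c : ℝ} (hc0 : 0 ≤ c)
    (hc : ∀ i ∈ S, c ≤ x i) : E.card * c ^ k ≤ weight E x := by
  rw [← nsmul_eq_mul]
  refine card_nsmul_le_sum _ _ _ fun e he => ?_
  obtain ⟨h1, h2⟩ := mem_powersetCard.1 (hE he)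
  rw [← h2, ← prod_const]
  exact prod_le_prod (fun i _ => hc0) fun i hi => hc i (h1 hi)

variable [DecidableEq α]

lemma linkAvoid_mono {E F : Finset (Finset α)} {x : α → ℝ} (hx : ∀ i, 0 ≤ x i) (h : E ⊆ F)
    (i j : α) : linkAvoid E x i j ≤ linkAvoid F x i j :=
  sum_le_sum_of_subset_of_nonneg (filter_subset_filter _ h) fun _ _ _ =>
    prod_nonneg fun i _ => hx i

lemma codeg_mono {E F : Finset (Finset α)} {x : α → ℝ} (hx : ∀ i, 0 ≤ x i) (h : E ⊆ F)
    (i j : α) : codeg E x i j ≤ codeg F x i j :=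
  sum_le_sum_of_subset_of_nonneg (filter_subset_filter _ h) fun _ _ _ =>
    prod_nonneg fun i _ => hx i

lemma linkAvoid_powersetCard_succ {S : Finset α} {i j : α} (hi : i ∈ S) (hij : i ≠ j) (k : ℕ)
    (x : α → ℝ) : linkAvoid (powersetCard (k + 1) S) x i j =
      weight (powersetCard k ((S.erase i).erase j)) x := by
  rw [erase_right_comm, ← link_powersetCard_succ (mem_erase.2 ⟨hij, hi⟩)]
  unfold linkAvoid link
  refine sum_congr ?_ fun _ _ => rfl
  ext e
  simp only [mem_filter, mem_powersetCard]
  constructor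
  · rintro ⟨⟨h1, h2⟩, h3, h4⟩
    exact ⟨⟨subset_erase.2 ⟨h1, h4⟩, h2⟩, h3⟩
  · rintro ⟨⟨h1, h2⟩, h3⟩
    obtain ⟨h5, h6⟩ := subset_erase.1 h1
    exact ⟨⟨h5, h2⟩, h3, h6⟩

lemma codeg_powersetCard_add_two {S : Finset α} {i j : α} (hi : i ∈ S) (hj : j ∈ S)
    (hij : i ≠ j) (k : ℕ) {x : α → ℝ} (hxj : x j ≠ 0) :
    codeg (powersetCard (k + 2) S) x i j = weight (powersetCard k ((S.erase i).erase j)) x := by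
  have h := link_eq_codeg_add (powersetCard (k + 2) S) x hij
  rw [link_powersetCard_succ hi (k + 1), linkAvoid_powersetCard_succ hi hij (k + 1)] at h
  have hj' : j ∈ S.erase i := mem_erase.2 ⟨hij.symm, hj⟩
  conv_lhs at h => rw [← insert_erase hj']
  rw [weight_powersetCard_succ_insert (by simp)] at h
  have h2 : x j * weight (powersetCard k ((S.erase i).erase j)) x =
      x j * codeg (powersetCard (k + 2) S) x i j := by linarith
  exact (mul_left_cancel₀ hxj h2).symm

/-- The members of an `r`-uniform family on `S ∪ {v}` that contains all `r`-subsets of `S` are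
these subsets and the sets `P ∪ {v}` with `P` in the link of `v`. -/
lemma sum_eq_sum_add_sum_insert {E : Finset (Finset α)} {k : ℕ} {S : Finset α} {v : α}
    (hv : v ∉ S) (hE : E ⊆ powersetCard (k + 1) (insert v S)) (hSE : powersetCard (k + 1) S ⊆ E)
    (g : Finset α → ℝ) :
    ∑ e ∈ E, g e = ∑ e ∈ powersetCard (k + 1) S, g e +
      ∑ P ∈ powersetCard k S with insert v P ∈ E, g (insert v P) := by
  rw [← sum_sdiff hSE, add_comm]
  congr 1
  symm
  refine sum_bij (fun P _ => insert v P) ?_ ?_ ?_ fun _ _ => rfl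
  · intro P hP
    simp only [mem_filter, mem_powersetCard, mem_sdiff] at hP ⊢
    exact ⟨hP.2, fun h => hv (h.1 (mem_insert_self _ _))⟩
  · intro P hP Q hQ h
    have hvP : v ∉ P := fun h => hv ((mem_powersetCard.1 (mem_filter.1 hP).1).1 h)
    have hvQ : v ∉ Q := fun h => hv ((mem_powersetCard.1 (mem_filter.1 hQ).1).1 h)
    rw [← erase_insert hvP, ← erase_insert hvQ, h]
  · intro e he
    obtain ⟨heE, heS⟩ := mem_sdiff.1 he
    obtain ⟨h1, h2⟩ := mem_powersetCard.1 (hE heE)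
    have hve : v ∈ e := by
      by_contra hve
      exact heS (mem_powersetCard.2 ⟨(subset_insert_iff_of_notMem hve).1 h1, h2⟩)
    refine ⟨e.erase v, ?_, insert_erase hve⟩
    simp only [mem_filter, mem_powersetCard, insert_erase hve]
    exact ⟨⟨subset_insert_iff.1 h1, by rw [card_erase_of_mem hve, h2]; rfl⟩, heE⟩

/-- The first order condition for the largest and the smallest weight of `S` bounds the link of
the latter in the family `A` of sets completed by the outer vertex. Here `y` is the weight of the
outer vertex. -/
lemma mul_link_le {S : Finset α} {k : ℕ} (hk : 1 ≤ k) {A : Finset (Finset α)}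
    (hA : A ⊆ powersetCard (k + 1) S) {x : α → ℝ} (hx : ∀ i, 0 ≤ x i) {a b : α} (ha : a ∈ S)
    (hb : b ∈ S) (hab : a ≠ b) (hle : x b ≤ x a) {y : ℝ} (hy : 0 < y) (hyb : y ≤ x b)
    (heq : link (powersetCard (k + 2) S) x a + y * link A x a =
      link (powersetCard (k + 2) S) x b + y * link A x b) :
    (x a - x b) * weight (powersetCard k ((S.erase a).erase b)) x ≤
        x b * weight (powersetCard k ((S.erase a).erase b)) x ∧
      x b * link A x b ≤ (2 * x b - x a) * weight (powersetCard k ((S.erase a).erase b)) x +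
        x b ^ 2 * weight (powersetCard (k - 1) ((S.erase a).erase b)) x := by
  have hxb : 0 < x b := hy.trans_le hyb
  set W := weight (powersetCard k ((S.erase a).erase b)) x with hW
  have hW0 : 0 ≤ W := weight_nonneg hx
  have h1 := link_sub_link_powersetCard (k + 2) x ha hb hab
  rw [codeg_powersetCard_add_two ha hb hab k hxb.ne', ← hW] at h1
  have h2 := link_eq_codeg_add A x hab
  have h3 := link_eq_codeg_add A x hab.symm
  rw [codeg_comm A x b a] at h3
  have hN : linkAvoid A x a b ≤ W := by
    rw [hW, ← linkAvoid_powersetCard_succ ha hab]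
    exact linkAvoid_mono hx hA a b
  have hU : codeg A x a b ≤ weight (powersetCard (k - 1) ((S.erase a).erase b)) x := by
    rw [← codeg_powersetCard_add_two ha hb hab (k - 1) hxb.ne',
      show k - 1 + 2 = k + 1 by omega]
    exact codeg_mono hx hA a b
  have hU0 : 0 ≤ codeg A x a b := codeg_nonneg hx a b
  have hT0 : 0 ≤ linkAvoid A x b a := sum_nonneg fun _ _ => prod_nonneg fun i _ => hx i
  set U := codeg A x a b with hUdef
  set N := linkAvoid A x a b
  set T := linkAvoid A x b a
  -- The first order condition, with `δ = x a - x b`.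
  have hfoc : (x a - x b) * (W + y * U) = y * (N - T) := by
    rw [h2, h3] at heq
    linarith
  have hδ : 0 ≤ x a - x b := sub_nonneg.2 hle
  have hmain : (x a - x b) * W + y * ((x a - x b) * U + T) ≤ y * W := by nlinarith
  have hrest : 0 ≤ (x a - x b) * U + T := add_nonneg (mul_nonneg hδ hU0) hT0
  have hmain' : (x a - x b) * W + x b * ((x a - x b) * U + T) ≤ x b * W := by
    -- Dividing by `y`, the first summand only gets smaller when `y` is replaced by `x b`.
    have h4 : 0 ≤ y * (W - ((x a - x b) * U + T)) - (x a - x b) * W := by linarith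
    have h5 : 0 ≤ W - ((x a - x b) * U + T) := by
      by_contra! hneg
      nlinarith [mul_nonneg hδ hW0]
    nlinarith [mul_le_mul_of_nonneg_right hyb h5]
  refine ⟨by nlinarith, ?_⟩
  rw [h3]
  nlinarith [mul_le_mul_of_nonneg_left hU (sq_nonneg (x b))]

/-- In the setting of `mul_link_le`, a family `A` that is not too large weighs no more than all
`(k+1)`-subsets of `S` that avoid the vertex `b` of smallest weight: the members of `A` through `b`
are paid for by the subsets avoiding `b` that are missing in `A`. -/
lemma weight_le_weight_of_isMax_link {S : Finset α} {k t : ℕ} (hk : 2 ≤ k) (ht : k + 2 ≤ t)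
    (hS : S.card = t) {A : Finset (Finset α)} (hAS : A ⊆ powersetCard (k + 1) S)
    (hcardA : (A.card : ℝ) ≤ (t - 1).choose (k + 1) - (2 ^ (k - 1) - 1) * ((t - 1).choose k - 1))
    {z : α → ℝ} (hz0 : ∀ i, 0 ≤ z i) {a b : α} (ha : a ∈ S) (hb : b ∈ S) (hab : a ≠ b)
    (hbmin : ∀ i ∈ S, z b ≤ z i) (hamax : ∀ i ∈ S, z i ≤ z a) {y : ℝ} (hy : 0 < y)
    (hyb : y ≤ z b)
    (heq : link (powersetCard (k + 2) S) z a + y * link A z a =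
      link (powersetCard (k + 2) S) z b + y * link A z b) :
    weight A z ≤ weight (powersetCard (k + 1) (S.erase b)) z := by
  have hb0 : 0 < z b := hy.trans_le hyb
  have hle : z b ≤ z a := hbmin a ha
  obtain ⟨hδ, hY⟩ := mul_link_le (by omega) hAS hz0 ha hb hab hle hy hyb heq
  set R := (S.erase a).erase b with hR
  have hRS : R ⊆ S := (erase_subset _ _).trans (erase_subset _ _)
  have hRcard : R.card = t - 2 := by
    rw [hR, card_erase_of_mem (mem_erase.2 ⟨hab.symm, hb⟩), card_erase_of_mem ha, hS]
    omega
  have hW0 : 0 < weight (powersetCard k R) z := by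
    have := card_mul_pow_le_weight (E := powersetCard k R) (k := k) (S := S)
      (powersetCard_mono hRS) hb0.le hbmin
    refine lt_of_lt_of_le ?_ this
    rw [card_powersetCard, hRcard]
    have : 0 < (t - 2).choose k := Nat.choose_pos (by omega)
    positivity
  have h2 : z a ≤ 2 * z b := by
    have := le_of_mul_le_mul_right hδ hW0
    linarith
  have hWle : weight (powersetCard k R) z ≤ (t - 2).choose k * z a ^ k := by
    have := weight_le_card_mul_pow (E := powersetCard k R) (k := k) (S := S)
      (powersetCard_mono hRS) hz0 hamax
    rwa [card_powersetCard, hRcard] at this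
  have hVle : weight (powersetCard (k - 1) R) z ≤ (t - 2).choose (k - 1) * z a ^ (k - 1) := by
    have := weight_le_card_mul_pow (E := powersetCard (k - 1) R) (k := k - 1) (S := S)
      (powersetCard_mono hRS) hz0 hamax
    rwa [card_powersetCard, hRcard] at this
  -- The sets of `S \ {b}` missing in `A`, and those of `A` that contain `b`.
  set B := powersetCard (k + 1) (S.erase b) \ A with hB
  set Ab := A.filter fun P => b ∈ P with hAb
  set An := A.filter fun P => b ∉ P with hAn
  have hAnS : An ⊆ powersetCard (k + 1) (S.erase b) := fun P hP => by
    obtain ⟨hPA, hbP⟩ := mem_filter.1 hP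
    obtain ⟨h3, h4⟩ := mem_powersetCard.1 (hAS hPA)
    exact mem_powersetCard.2 ⟨subset_erase.2 ⟨h3, hbP⟩, h4⟩
  have hBeq : B = powersetCard (k + 1) (S.erase b) \ An := by
    ext P
    simp only [hB, hAn, mem_sdiff, mem_filter, mem_powersetCard, not_and, not_not]
    refine and_congr_right fun h => ⟨fun h1 h2 => absurd h2 h1, fun h1 h2 => ?_⟩
    exact absurd (h.1 (h1 h2)) (notMem_erase b S)
  have hBcard : (B.card : ℝ) = (t - 1).choose (k + 1) - An.card := by
    rw [hBeq, cast_card_sdiff hAnS, card_powersetCard, card_erase_of_mem hb, hS]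
  have hAcard : (A.card : ℝ) = Ab.card + An.card := by
    exact_mod_cast (card_filter_add_card_filter_not (s := A) fun P => b ∈ P).symm
  have hYa : link A z b ≤ Ab.card * z a ^ k := by
    unfold link
    rw [← nsmul_eq_mul]
    refine sum_le_card_nsmul _ _ _ fun P hP => ?_
    obtain ⟨hPA, hbP⟩ := mem_filter.1 hP
    obtain ⟨h3, h4⟩ := mem_powersetCard.1 (hAS hPA)
    have h5 : (P.erase b).card = k := by rw [card_erase_of_mem hbP, h4]; rfl
    rw [← h5, ← prod_const]
    exact prod_le_prod (fun i _ => hz0 i) fun i hi => hamax i (h3 (mem_of_mem_erase hi))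
  have hBle := card_mul_pow_le_weight (E := B) (k := k + 1) (S := S)
    (sdiff_subset.trans (powersetCard_mono (erase_subset b S))) hb0.le hbmin
  -- The quantities relative to the smallest weight.
  have ht1 : t - 1 = t - 2 + 1 := by omega
  have hpas : ((t - 1).choose k : ℝ) = (t - 2).choose k + (t - 2).choose (k - 1) := by
    obtain ⟨j, rfl⟩ : ∃ j, k = j + 1 := ⟨k - 1, by omega⟩
    rw [ht1, Nat.choose_succ_succ]
    push_cast
    rw [add_comm]
  have hcondA : ((2 : ℝ) ^ (k - 1) - 1) * ((t - 1).choose k - 1) + Ab.card ≤ B.card := by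
    rw [hBcard]
    linarith
  have hcond : ((2 : ℝ) ^ (k - 1) - 1) * ((t - 2 + 1).choose k - 1) ≤
      (t - 2 + 1).choose (k + 1) := by
    rw [← ht1]
    have h3 : (0 : ℝ) ≤ An.card := by positivity
    have h4 : (0 : ℝ) ≤ Ab.card := by positivity
    linarith
  have hzab : z a = z a / z b * z b := by field_simp
  set β := z a / z b with hβ
  have hβ1 : 1 ≤ β := (one_le_div hb0).2 hle
  have hβ2 : β ≤ 2 := (div_le_iff₀ hb0).2 h2
  have hkey : link A z b / z b ^ k ≤ B.card := by
    refine le_trans (sub_le_of_choose (n := t - 2) (k := k) (a := Ab.card) hk (by omega) hcond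
      hβ1 hβ2 ?_ ?_) (le_trans (le_of_eq ?_) hcondA)
    · rw [div_le_iff₀ (by positivity), mul_assoc, ← mul_pow, ← hzab]
      exact hYa
    · rw [div_le_iff₀ (by positivity)]
      refine le_of_mul_le_mul_left (hY.trans ?_) hb0
      have h3 : (2 * z b - z a) * weight (powersetCard k R) z ≤
          (2 * z b - z a) * ((t - 2).choose k * z a ^ k) :=
        mul_le_mul_of_nonneg_left hWle (by linarith)
      have h4 : z b ^ 2 * weight (powersetCard (k - 1) R) z ≤
          z b ^ 2 * ((t - 2).choose (k - 1) * z a ^ (k - 1)) :=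
        mul_le_mul_of_nonneg_left hVle (by positivity)
      refine (add_le_add h3 h4).trans (le_of_eq ?_)
      obtain ⟨j, rfl⟩ : ∃ j, k = j + 1 := ⟨k - 1, by omega⟩
      rw [hzab]
      simp only [show j + 1 - 1 = j from rfl, mul_pow]
      ring
    · rw [hpas]
      ring
  have hmerge : z b * link A z b ≤ weight B z := by
    rw [div_le_iff₀ (by positivity)] at hkey
    refine le_trans ?_ hBle
    rw [pow_succ']
    nlinarith
  have hwA : weight A z = z b * link A z b + weight An z := by
    unfold weight link
    rw [← sum_filter_add_sum_filter_not A (fun P => b ∈ P), mul_sum]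
    congr 1
    exact sum_congr rfl fun P hP => (mul_prod_erase P z (mem_filter.1 hP).2).symm
  have hwB : weight (powersetCard (k + 1) (S.erase b)) z = weight B z + weight An z := by
    rw [hBeq]
    exact (sum_sdiff hAnS).symm
  rw [hwA, hwB]
  linarith

variable [Fintype α]

/-- Some maximizer gives its smallest weight to the vertex outside a complete subgraph. -/
lemma exists_isMax_weight_of_complete {E : Finset (Finset α)} {k : ℕ} {S : Finset α}
    (hSne : S.Nonempty) {v : α} (hv : v ∉ S) (hE : E ⊆ powersetCard (k + 2) (insert v S))
    (hSE : powersetCard (k + 2) S ⊆ E) :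
    ∃ z ∈ weightings (↑(insert v S) : Set α),
      (∀ w ∈ weightings (↑(insert v S) : Set α), weight E w ≤ weight E z) ∧
        ∀ i ∈ S, z v ≤ z i := by
  obtain ⟨z, hz, hzmax⟩ := exists_isMax_weight E (V := (↑(insert v S) : Set α)) ⟨v, by simp⟩
  obtain ⟨b, hb, hbmin⟩ := exists_min_image S z hSne
  rcases le_or_gt (z v) (z b) with hle | hlt
  · exact ⟨z, hz, hzmax, fun i hi => hle.trans (hbmin i hi)⟩
  have hbv : b ≠ v := fun h => hv (h ▸ hb)
  have hz0 := hz.1.1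
  -- This shift exchanges the weights of `b` and `v`.
  refine ⟨shift z b v (z v - z b), shift_mem_weightings hz hbv (by simp [hb])
    (by linarith) (by linarith [hz0 b]), fun w hw => (hzmax w hw).trans ?_, fun i hi => ?_⟩
  · rw [weight_shift E z hbv, link_eq_codeg_add E z hbv, link_eq_codeg_add E z hbv.symm,
      codeg_comm E z v b]
    have h1 : linkAvoid E z v b ≤ linkAvoid E z b v := by
      have h2 : linkAvoid E z v b ≤ weight (powersetCard (k + 1) ((S.erase b).erase v)) z := by
        have h3 : linkAvoid E z v b ≤ linkAvoid (powersetCard (k + 2) (insert v S)) z v b :=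
          linkAvoid_mono hz0 hE v b
        rwa [linkAvoid_powersetCard_succ (mem_insert_self v S) hbv.symm, erase_insert hv,
          ← erase_eq_of_notMem (fun h => hv (mem_of_mem_erase h) : v ∉ S.erase b)] at h3
      refine h2.trans ?_
      rw [← linkAvoid_powersetCard_succ hb hbv]
      exact linkAvoid_mono hz0 hSE b v
    nlinarith [mul_nonneg (sub_nonneg.2 hlt.le) (sub_nonneg.2 h1)]
  · have h1 : shift z b v (z v - z b) v = z b := by simp [shift, hbv.symm]
    rw [h1]
    unfold shift
    split_ifs with h2 h3
    · linarith
    · exact absurd (h3 ▸ hi) hv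
    · exact hbmin i hi

/-- An `r`-graph on `t + 1` vertices (`r = k + 2 ≥ 4`) with a complete subgraph of order `t` and
not too many edges has the Lagrangian of that subgraph: in an optimal weighting, merging the outer
vertex into the smallest weight of the subgraph does not decrease the value. -/
lemma weight_le_of_complete_insert {E : Finset (Finset α)} {k t : ℕ} (hk : 2 ≤ k)
    (ht : k + 2 ≤ t) {S : Finset α} (hS : S.card = t) {v : α} (hv : v ∉ S)
    (hE : E ⊆ powersetCard (k + 2) (insert v S)) (hSE : powersetCard (k + 2) S ⊆ E)
    (hcard : (E.card : ℝ) ≤ t.choose (k + 2) + (t - 1).choose (k + 1) -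
      (2 ^ (k - 1) - 1) * ((t - 1).choose k - 1))
    {x : α → ℝ} (hx : x ∈ weightings (↑(insert v S) : Set α)) :
    weight E x ≤ t.choose (k + 2) * (1 / (t : ℝ)) ^ (k + 2) := by
  have hEcard : ∀ e ∈ E, e.card = k + 2 := fun e he => (mem_powersetCard.1 (hE he)).2
  set A := (powersetCard (k + 1) S).filter fun P => insert v P ∈ E with hA
  have hAS : A ⊆ powersetCard (k + 1) S := filter_subset _ _
  have hvA : ∀ P ∈ A, v ∉ P := fun P hP h => hv ((mem_powersetCard.1 (hAS hP)).1 h)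
  have hdec : ∀ g : Finset α → ℝ, ∑ e ∈ E, g e =
      ∑ e ∈ powersetCard (k + 2) S, g e + ∑ P ∈ A, g (insert v P) :=
    sum_eq_sum_add_sum_insert hv hE hSE
  have hmaxle : ∀ z ∈ weightings (S : Set α),
      weight E z ≤ t.choose (k + 2) * (1 / (t : ℝ)) ^ (k + 2) := fun z hz => by
    rw [← hS]
    exact (weight_le_of_mem_weightings hEcard hz).trans (weight_powersetCard_le (by omega) hz)
  have hSne : S.Nonempty := card_pos.1 (by omega)
  obtain ⟨z, hz, hzmax, hzv⟩ := exists_isMax_weight_of_complete hSne hv hE hSE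
  refine (hzmax x hx).trans ?_
  have hz0 := hz.1.1
  rcases (hz0 v).eq_or_lt with hy | hy
  · refine hmaxle z ⟨hz.1, fun i hi => ?_⟩
    by_cases hiv : i = v
    · rw [hiv, ← hy]
    · exact hz.2 i (by simpa [hiv] using hi)
  obtain ⟨b, hb, hbmin⟩ := exists_min_image S z hSne
  have hyb : z v ≤ z b := hzv b hb
  have hb0 : 0 < z b := hy.trans_le hyb
  have hbv : b ≠ v := fun h => hv (h ▸ hb)
  obtain ⟨a, ha', hamax'⟩ := exists_max_image (S.erase b) z
    (card_pos.1 (by rw [card_erase_of_mem hb]; omega))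
  obtain ⟨hab, ha⟩ := mem_erase.1 ha'
  have hle : z b ≤ z a := hbmin a ha
  have hamax : ∀ i ∈ S, z i ≤ z a := fun i hi => by
    by_cases h : i = b
    · rw [h]; exact hle
    · exact hamax' i (mem_erase.2 ⟨h, hi⟩)
  have hlink : ∀ i ∈ S, link E z i = link (powersetCard (k + 2) S) z i + z v * link A z i := by
    intro i hi
    have hiv : i ≠ v := fun h => hv (h ▸ hi)
    unfold link
    rw [sum_filter, hdec, ← sum_filter, sum_filter (s := A), mul_sum]
    congr 1
    refine sum_congr rfl fun P hP => ?_
    simp only [mem_insert, hiv, false_or]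
    split_ifs with h
    · rw [erase_insert_of_ne hiv.symm, prod_insert fun h => hvA P hP (mem_of_mem_erase h)]
    · simp
  have hlab : link E z a = link E z b := by
    rw [link_eq_of_isMax hEcard hz hzmax (hb0.trans_le hle),
      link_eq_of_isMax hEcard hz hzmax hb0]
  rw [hlink a ha, hlink b hb] at hlab
  have hcardA : (A.card : ℝ) ≤ (t - 1).choose (k + 1) -
      (2 ^ (k - 1) - 1) * ((t - 1).choose k - 1) := by
    have hEcard' : (E.card : ℝ) = t.choose (k + 2) + A.card := by
      have := hdec fun _ => (1 : ℝ)
      simpa [hS] using this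
    linarith
  have hmerge := weight_le_weight_of_isMax_link hk ht hS hAS hcardA hz0 ha hb hab hbmin hamax hy
    hyb hlab
  -- Merging `v` into `b`.
  have hzS : shift z b v (z v) ∈ weightings (S : Set α) := by
    have := shift_mem_weightings hz hbv (by simp [hb]) hy.le le_rfl
    refine ⟨this.1, fun i hi => ?_⟩
    by_cases hiv : i = v
    · rw [hiv]
      simp [shift, hbv.symm]
    · exact this.2 i (by simpa [hiv] using hi)
  have hfin := weight_powersetCard_le (r := k + 2) (by omega) hzS
  rw [hS] at hfin
  refine le_trans ?_ hfin
  have hlv : link (powersetCard (k + 2) S) z v = 0 := by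
    unfold link
    rw [filter_eq_empty_iff.2 fun e he h => hv ((mem_powersetCard.1 he).1 h), sum_empty]
  have hcv : codeg (powersetCard (k + 2) S) z b v = 0 := by
    unfold codeg
    rw [filter_eq_empty_iff.2 fun e he h => hv ((mem_powersetCard.1 he).1 h.2), sum_empty]
  rw [weight_shift _ _ hbv, hlv, hcv, link_powersetCard_succ hb (k + 1)]
  have hwE : weight E z = weight (powersetCard (k + 2) S) z + z v * weight A z := by
    unfold weight
    rw [hdec, mul_sum]
    congr 1
    exact sum_congr rfl fun P hP => prod_insert (hvA P hP)
  rw [hwE]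
  nlinarith [mul_le_mul_of_nonneg_left hmerge hy.le]

end OneOuterVertex

/-! ### Graph-Lagrangians of hypergraphs -/

section Hypergraph

lemma card_mem_of_mem_edgeSet {H : Hypergraph α} {T : Set ℕ} (hT : H.edgeTypes = T)
    {e : Finset α} (he : (e : Set α) ∈ H.edgeSet) : e.card ∈ T := by
  rw [← hT, ← Set.ncard_coe_finset]
  exact Set.mem_image_of_mem _ he

/-- A complete `3`-graph on `t + 1` vertices has too many edges. -/
lemma card_le_of_powersetCard_three_subset {E : Finset (Finset α)} {t : ℕ} (ht : 3 ≤ t)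
    (hcard : (E.card : ℝ) ≤ t.choose 3 + (t - 1).choose 2 - (t : ℝ) / 2) {S : Finset α}
    (hS : powersetCard 3 S ⊆ E) : S.card ≤ t := by
  by_contra! hlt
  have h1 := card_le_card hS
  rw [card_powersetCard] at h1
  have h2 : (t + 1).choose 3 ≤ S.card.choose 3 := Nat.choose_le_choose _ hlt
  have h3 : (t + 1).choose 3 = t.choose 2 + t.choose 3 := Nat.choose_succ_succ t 2
  have h4 : (t - 1).choose 2 ≤ t.choose 2 := Nat.choose_le_choose _ (by omega)
  have h5 : (t.choose 3 + (t - 1).choose 2 : ℝ) ≤ E.card := by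
    exact_mod_cast (by omega : t.choose 3 + (t - 1).choose 2 ≤ E.card)
  have h6 : (3 : ℝ) ≤ t := by exact_mod_cast ht
  linarith

variable [Fintype α]

open Classical in
/-- The edges of `H` with exactly `r` vertices, as a family of finsets. -/
noncomputable def edgesOfCard (H : Hypergraph α) (r : ℕ) : Finset (Finset α) :=
  univ.filter fun e => (e : Set α) ∈ H.edgeSet ∧ e.card = r

lemma mem_edgesOfCard {H : Hypergraph α} {r : ℕ} {e : Finset α} :
    e ∈ edgesOfCard H r ↔ (e : Set α) ∈ H.edgeSet ∧ e.card = r := by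
  simp [edgesOfCard]

lemma card_eq_of_mem_edgesOfCard {H : Hypergraph α} {r : ℕ} :
    ∀ e ∈ edgesOfCard H r, e.card = r := fun _ he => (mem_edgesOfCard.1 he).2

lemma ncard_level_edgeSet (H : Hypergraph α) (r : ℕ) :
    (H.level r).edgeSet.ncard = (edgesOfCard H r).card := by
  have h : (H.level r).edgeSet = (fun e : Finset α => (e : Set α)) '' ↑(edgesOfCard H r) := by
    classical
    ext s
    simp only [Hypergraph.level, Set.mem_ofPred_eq, Set.mem_image, mem_coe, mem_edgesOfCard]
    constructor
    · rintro ⟨h1, h2⟩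
      refine ⟨s.toFinset, ⟨by simpa using h1, ?_⟩, by simp⟩
      rw [← h2, Set.ncard_eq_toFinset_card']
    · rintro ⟨e, ⟨h1, h2⟩, rfl⟩
      exact ⟨h1, by rw [Set.ncard_coe_finset, h2]⟩
  rw [h, Set.ncard_image_of_injective _ coe_injective, Set.ncard_coe_finset]

lemma exists_mem_edgesOfCard {H : Hypergraph α} {r : ℕ} (hr : r ∈ H.edgeTypes) :
    ∃ e, e ∈ edgesOfCard H r := by
  classical
  obtain ⟨s, hs, rfl⟩ := hr
  exact ⟨s.toFinset, mem_edgesOfCard.2 ⟨by simpa using hs, (Set.ncard_eq_toFinset_card' s).symm⟩⟩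

lemma lagrangianPoly_eq_sum {H : Hypergraph α} {T : Finset ℕ} (hT : H.edgeTypes = ↑T)
    (x : α → ℝ) :
    H.lagrangianPoly x = ∑ r ∈ T, (r.factorial : ℝ) * weight (edgesOfCard H r) x := by
  classical
  unfold Hypergraph.lagrangianPoly
  rw [← sum_fiberwise_of_maps_to (g := card) (t := T)
    fun e he => mem_coe.1 (card_mem_of_mem_edgeSet hT (by simpa using he))]
  refine sum_congr rfl fun r _ => ?_
  unfold weight edgesOfCard
  rw [mul_sum, filter_filter]
  refine sum_congr (by ext; simp) fun e he => ?_
  rw [(mem_filter.1 he).2.2]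

lemma feasibleWeightings_eq (H : Hypergraph α) :
    H.feasibleWeightings = weightings H.vertexSet := rfl

lemma mem_weightings_univ {H : Hypergraph α} {x : α → ℝ} (hx : x ∈ H.feasibleWeightings) :
    x ∈ weightings Set.univ := ⟨hx.1, fun i hi => absurd (Set.mem_univ i) hi⟩

lemma powersetCard_subset_edgesOfCard {H : Hypergraph α} {T : Set ℕ} {S : Finset α}
    (hS : H.IsCompleteSubgraph T S) {r : ℕ} (hr : r ∈ T) :
    powersetCard r S ⊆ edgesOfCard H r := fun e he => by
  obtain ⟨h1, h2⟩ := mem_powersetCard.1 he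
  exact mem_edgesOfCard.2 ⟨hS.2.2 e h1 (h2 ▸ hr), h2⟩

lemma edgesOfCard_subset_powersetCard (H : Hypergraph α) {W : Finset α} (hW : H.vertexSet ⊆ ↑W)
    (r : ℕ) : edgesOfCard H r ⊆ powersetCard r W := fun e he => by
  obtain ⟨h1, h2⟩ := mem_edgesOfCard.1 he
  exact mem_powersetCard.2 ⟨coe_subset.1 ((H.subset_vertexSet_of_mem_edgeSet h1).trans hW), h2⟩

/-- A complete subgraph carries the weighting that is uniform on it. -/
lemma le_lagrangian {H : Hypergraph α} {T : Finset ℕ} (hT : H.edgeTypes = ↑T) {S : Finset α}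
    (hS : H.IsCompleteSubgraph ↑T S) {t : ℕ} (hSt : S.card = t) (ht : 1 ≤ t) :
    ∑ r ∈ T, (r.factorial : ℝ) * (t.choose r * (1 / (t : ℝ)) ^ r) ≤ H.lagrangian := by
  classical
  have ht0 : (0 : ℝ) < t := by exact_mod_cast ht
  obtain ⟨v, hv⟩ : S.Nonempty := card_pos.1 (by omega)
  set x : α → ℝ := fun i => if i ∈ S then 1 / (t : ℝ) else 0 with hxdef
  have hx0 : ∀ i, 0 ≤ x i := fun i => by
    simp only [hxdef]
    split_ifs <;> positivity
  have hx : x ∈ H.feasibleWeightings := by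
    refine ⟨⟨hx0, ?_⟩, fun i hi => if_neg fun h => hi (hS.1 h)⟩
    rw [sum_ite_mem, univ_inter, sum_const, hSt, nsmul_eq_mul]
    field_simp
  refine le_trans ?_ ((H.isGreatest_lagrangian ⟨v, hS.1 hv⟩).2 (Set.mem_image_of_mem _ hx))
  rw [lagrangianPoly_eq_sum hT]
  refine sum_le_sum fun r hr => mul_le_mul_of_nonneg_left ?_ (by positivity)
  rw [← hSt, ← weight_powersetCard_const r fun i hi => (if_pos hi).trans (by rw [hSt])]
  exact weight_mono hx0 (powersetCard_subset_edgesOfCard hS (mem_coe.2 hr))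

lemma lagrangian_le {H : Hypergraph α} (hH : H.vertexSet.Nonempty) {c : ℝ}
    (hc : ∀ x ∈ H.feasibleWeightings, H.lagrangianPoly x ≤ c) : H.lagrangian ≤ c := by
  obtain ⟨x, hx, hxH⟩ := (H.isGreatest_lagrangian hH).1
  exact hxH ▸ hc x hx

lemma edgeTypes_completeTypes {T : Set ℕ} {t : ℕ} (hT : ∀ r ∈ T, r ≤ t) :
    (Hypergraph.completeTypes T t).edgeTypes = T := by
  ext r
  constructor
  · rintro ⟨e, he, rfl⟩
    exact he
  · intro hr
    obtain ⟨e, -, he⟩ := exists_subset_card_eq (s := (univ : Finset (Fin t))) (n := r)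
      (by simpa using hT r hr)
    refine ⟨e, ?_, by rw [Set.ncard_coe_finset, he]⟩
    change (e : Set (Fin t)).ncard ∈ T
    rwa [Set.ncard_coe_finset, he]

lemma weight_powersetCard_univ_le {t r : ℕ} (ht : 1 ≤ t) (hr : 1 ≤ r) {x : Fin t → ℝ}
    (hx : x ∈ weightings Set.univ) :
    weight (powersetCard r univ) x ≤ t.choose r * (1 / (t : ℝ)) ^ r := by
  rcases hr.eq_or_lt with rfl | hr
  · have ht0 : (t : ℝ) ≠ 0 := by exact_mod_cast (by omega : t ≠ 0)
    rw [weight_powersetCard_one, hx.1.2, Nat.choose_one_right, pow_one, mul_one_div_cancel ht0]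
  · have h := weight_powersetCard_le (S := (univ : Finset (Fin t))) hr (by rwa [coe_univ])
    rwa [card_univ, Fintype.card_fin] at h

/-- The graph-Lagrangian of a complete hypergraph is attained at the uniform weighting. -/
lemma lagrangian_completeTypes {T : Finset ℕ} {t : ℕ} (hT1 : ∀ r ∈ T, 1 ≤ r)
    (hTt : ∀ r ∈ T, r ≤ t) (ht : 1 ≤ t) :
    (Hypergraph.completeTypes ↑T t).lagrangian =
      ∑ r ∈ T, (r.factorial : ℝ) * (t.choose r * (1 / (t : ℝ)) ^ r) := by
  have hT := edgeTypes_completeTypes (T := (T : Set ℕ)) (t := t) fun r hr => hTt r hr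
  refine le_antisymm (lagrangian_le ⟨⟨0, ht⟩, Set.mem_univ _⟩ fun x hx => ?_)
    (le_lagrangian (S := univ) hT ⟨?_, ?_, ?_⟩ (by simp) ht)
  · rw [lagrangianPoly_eq_sum hT]
    refine sum_le_sum fun r hr => mul_le_mul_of_nonneg_left ?_ (by positivity)
    refine (weight_mono hx.1.1 (edgesOfCard_subset_powersetCard _ (W := univ) (by simp) r)).trans ?_
    exact weight_powersetCard_univ_le ht (hT1 r hr) (mem_weightings_univ hx)
  · simp [Hypergraph.completeTypes]
  · intro r hr
    simpa using hTt r hr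
  · intro e _ he
    change (e : Set (Fin t)).ncard ∈ (T : Set ℕ)
    rwa [Set.ncard_coe_finset]

lemma lagrangian_eq_completeTypes {H : Hypergraph α} {T : Finset ℕ} (hT : H.edgeTypes = ↑T)
    (hT1 : ∀ r ∈ T, 1 ≤ r) {S : Finset α} (hS : H.IsCompleteSubgraph ↑T S) {t : ℕ}
    (hSt : S.card = t) (ht : 1 ≤ t)
    (hle : ∀ x ∈ H.feasibleWeightings, ∑ r ∈ T, (r.factorial : ℝ) * weight (edgesOfCard H r) x ≤
      ∑ r ∈ T, (r.factorial : ℝ) * (t.choose r * (1 / (t : ℝ)) ^ r)) :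
    H.lagrangian = (Hypergraph.completeTypes ↑T t).lagrangian := by
  obtain ⟨v, hv⟩ : S.Nonempty := card_pos.1 (by omega)
  rw [lagrangian_completeTypes hT1 (fun r hr => hSt ▸ hS.2.1 r hr) ht]
  refine le_antisymm (lagrangian_le ⟨v, hS.1 hv⟩ fun x hx => ?_) (le_lagrangian hT hS hSt ht)
  rw [lagrangianPoly_eq_sum hT]
  exact hle x hx

lemma two_mul_choose_two_mul {t : ℕ} (ht : 1 ≤ t) :
    2 * ((t.choose 2 : ℝ) * (1 / (t : ℝ)) ^ 2) = 1 - 1 / t := by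
  have ht0 : (t : ℝ) ≠ 0 := by exact_mod_cast (by omega : t ≠ 0)
  rw [Nat.cast_choose_two]
  field_simp

lemma subset_vertexSet_of_powersetCard_two {H : Hypergraph α} {S : Finset α} (hS : 2 ≤ S.card)
    (h : powersetCard 2 S ⊆ edgesOfCard H 2) : (S : Set α) ⊆ H.vertexSet := by
  classical
  intro i hi
  obtain ⟨j, hj, hji⟩ := exists_mem_ne (by omega : 1 < S.card) i
  have he : ({i, j} : Finset α) ∈ edgesOfCard H 2 := h (mem_powersetCard.2
    ⟨by simp [insert_subset_iff, mem_coe.1 hi, hj], card_pair hji.symm⟩)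
  exact H.subset_vertexSet_of_mem_edgeSet (mem_edgesOfCard.1 he).1 (by simp)

/-- For `{2,r}`-graphs the Motzkin–Straus theorem, applied with all singletons, reduces the claim
to the edges of size `r`. -/
lemma lagrangian_eq_of_two {H : Hypergraph α} {r t : ℕ} (hr : 3 ≤ r)
    (hT : H.edgeTypes = {2, r}) (hmax : H.HasMaxCompleteOrder {2, r} t)
    (hmax₂ : H.HasMaxCompleteOrder {2} t)
    (hle : ∀ x ∈ H.feasibleWeightings,
      weight (edgesOfCard H r) x ≤ t.choose r * (1 / (t : ℝ)) ^ r) :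
    H.lagrangian = (Hypergraph.completeTypes {2, r} t).lagrangian := by
  classical
  obtain ⟨S, hS, hSt⟩ := hmax.1
  have ht : 2 ≤ t := hSt ▸ hS.2.1 2 (by simp)
  have hcoe : ((({2, r} : Finset ℕ)) : Set ℕ) = {2, r} := by simp
  rw [← hcoe] at hT hS ⊢
  refine lagrangian_eq_completeTypes hT (fun s hs => ?_) hS hSt (by omega) fun x hx => ?_
  · simp only [mem_insert, mem_singleton] at hs
    omega
  have h2 := motzkin_straus (E₁ := powersetCard 1 univ) (E₂ := edgesOfCard H 2)
    (fun e he => (mem_powersetCard.1 he).2) card_eq_of_mem_edgesOfCard ht (fun U _ hU => ?_)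
    (mem_weightings_univ hx)
  · rw [weight_powersetCard_one, hx.1.2] at h2
    have h3 := two_mul_choose_two_mul (t := t) (by omega)
    rw [sum_pair (by omega), sum_pair (by omega)]
    refine add_le_add ?_ (mul_le_mul_of_nonneg_left (hle x hx) (by positivity))
    norm_num [Nat.factorial] at h2 h3 ⊢
    linarith
  · by_contra! hlt
    refine absurd (hmax₂.2 ⟨U, ⟨?_, ?_, fun e he hc => ?_⟩, rfl⟩) (by omega)
    · exact subset_vertexSet_of_powersetCard_two (by omega) hU
    · rintro k rfl
      omega
    · exact (mem_edgesOfCard.1 (hU (mem_powersetCard.2 ⟨he, hc⟩))).1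

lemma lagrangian_eq_of_one_two {H : Hypergraph α} {r t : ℕ} (hr : 3 ≤ r)
    (hT : H.edgeTypes = {1, 2, r}) (hmax : H.HasMaxCompleteOrder {1, 2, r} t)
    (hmax₂ : H.HasMaxCompleteOrder {1, 2} t)
    (hle : ∀ x ∈ H.feasibleWeightings,
      weight (edgesOfCard H r) x ≤ t.choose r * (1 / (t : ℝ)) ^ r) :
    H.lagrangian = (Hypergraph.completeTypes {1, 2, r} t).lagrangian := by
  classical
  obtain ⟨S, hS, hSt⟩ := hmax.1
  have ht : 2 ≤ t := hSt ▸ hS.2.1 2 (by simp)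
  have ht0 : (t : ℝ) ≠ 0 := by exact_mod_cast (by omega : t ≠ 0)
  have hcoe : ((({1, 2, r} : Finset ℕ)) : Set ℕ) = {1, 2, r} := by simp
  rw [← hcoe] at hT hS ⊢
  refine lagrangian_eq_completeTypes hT (fun s hs => ?_) hS hSt (by omega) fun x hx => ?_
  · simp only [mem_insert, mem_singleton] at hs
    omega
  have h2 := motzkin_straus (E₁ := edgesOfCard H 1) (E₂ := edgesOfCard H 2)
    card_eq_of_mem_edgesOfCard card_eq_of_mem_edgesOfCard ht (fun U hU₁ hU => ?_)
    (mem_weightings_univ hx)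
  · have h3 := two_mul_choose_two_mul (t := t) (by omega)
    have h1 : (1 : ℕ) ∉ ({2, r} : Finset ℕ) := by
      simp only [mem_insert, mem_singleton]
      omega
    rw [sum_insert h1, sum_insert h1, sum_pair (by omega), sum_pair (by omega), ← add_assoc,
      ← add_assoc]
    refine add_le_add ?_ (mul_le_mul_of_nonneg_left (hle x hx) (by positivity))
    rw [Nat.choose_one_right, pow_one, mul_one_div_cancel ht0]
    norm_num [Nat.factorial] at h2 h3 ⊢
    linarith
  · by_contra! hlt
    refine absurd (hmax₂.2 ⟨U, ⟨?_, ?_, fun e he hc => ?_⟩, rfl⟩) (by omega)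
    · exact subset_vertexSet_of_powersetCard_two (by omega) hU
    · rintro k (rfl | rfl) <;> omega
    · rcases hc with hc | hc
      · obtain ⟨i, rfl⟩ := card_eq_one.1 hc
        exact (mem_edgesOfCard.1 (hU₁ i (singleton_subset_iff.1 he))).1
      · exact (mem_edgesOfCard.1 (hU (mem_powersetCard.2 ⟨he, hc⟩))).1

lemma weight_edgesOfCard_three_le {H : Hypergraph α} {T : Set ℕ} {t m : ℕ} (h3 : 3 ∈ T)
    (hmax : H.HasMaxCompleteOrder T t) (hm : (H.level 3).edgeSet.ncard = m)
    (hle : m ≤ t.choose 3 + (t - 1).choose 2) {x : α → ℝ} (hx : x ∈ H.feasibleWeightings) :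
    weight (edgesOfCard H 3) x ≤ t.choose 3 * (1 / (t : ℝ)) ^ 3 := by
  classical
  obtain ⟨S, hS, hSt⟩ := hmax.1
  rw [ncard_level_edgeSet] at hm
  exact weight_le_of_complete card_eq_of_mem_edgesOfCard (hSt ▸ hS.2.1 3 h3) (hm ▸ hle) hSt
    (powersetCard_subset_edgesOfCard hS h3) (mem_weightings_univ hx)

lemma weight_edgesOfCard_le {H : Hypergraph α} {T : Set ℕ} {r t m : ℕ} (hr : 3 ≤ r)
    (hrT : r ∈ T) (hV : H.vertexSet.ncard = t + 1) (hmax : H.HasMaxCompleteOrder T t)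
    (hm : (H.level r).edgeSet.ncard = m)
    (hle : (m : ℤ) ≤ t.choose r + (t - 1).choose (r - 1)
      - (2 ^ (r - 3) - 1) * ((t - 1).choose (r - 2) - 1))
    {x : α → ℝ} (hx : x ∈ H.feasibleWeightings) :
    weight (edgesOfCard H r) x ≤ t.choose r * (1 / (t : ℝ)) ^ r := by
  classical
  rcases hr.eq_or_lt with rfl | hr
  · refine weight_edgesOfCard_three_le hrT hmax hm ?_ hx
    simp only [Nat.sub_self, pow_zero, sub_self, zero_mul, sub_zero] at hle
    exact_mod_cast hle
  obtain ⟨S, hS, hSt⟩ := hmax.1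
  obtain ⟨k, rfl⟩ : ∃ k, r = k + 2 := ⟨r - 2, by omega⟩
  obtain ⟨v, hv, hvS⟩ : ∃ v, v ∉ S ∧ H.vertexSet = ↑(insert v S) := by
    have h1 : (S : Set α).ncard + 1 = H.vertexSet.ncard := by
      rw [Set.ncard_coe_finset, hSt, hV]
    obtain ⟨v, hv, h2⟩ := (Set.exists_eq_insert_iff_ncard (Set.toFinite _)).2 ⟨hS.1, h1⟩
    exact ⟨v, hv, by rw [coe_insert, h2]⟩
  rw [ncard_level_edgeSet] at hm
  refine weight_le_of_complete_insert (by omega) (hSt ▸ hS.2.1 _ hrT) hSt hv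
    (edgesOfCard_subset_powersetCard H hvS.subset _) (powersetCard_subset_edgesOfCard hS hrT) ?_
    (by rwa [feasibleWeightings_eq, hvS] at hx)
  rw [hm]
  exact_mod_cast hle

lemma hasMaxCompleteOrder_of_three_mem {H : Hypergraph α} {t : ℕ} (ht : 3 ≤ t)
    (hcard : ((edgesOfCard H 3).card : ℝ) ≤ t.choose 3 + (t - 1).choose 2 - (t : ℝ) / 2)
    {T : Set ℕ} (h3 : 3 ∈ T) {S : Finset α} (hS : H.IsCompleteSubgraph T S) (hSt : S.card = t) :
    H.HasMaxCompleteOrder T t := by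
  refine ⟨⟨S, hS, hSt⟩, ?_⟩
  rintro n ⟨U, hU, rfl⟩
  exact card_le_of_powersetCard_three_subset ht hcard (powersetCard_subset_edgesOfCard hU h3)

lemma weight_le_one_of_card_eq_one {E : Finset (Finset α)} (hE : ∀ e ∈ E, e.card = 1)
    {x : α → ℝ} (hx : x ∈ weightings Set.univ) : weight E x ≤ 1 := by
  have h := weight_mono hx.1.1 (show E ⊆ powersetCard 1 univ from fun e he =>
    mem_powersetCard.2 ⟨subset_univ _, hE e he⟩)
  rwa [weight_powersetCard_one, hx.1.2] at h

lemma singleton_mem_of_one_le_weight {E : Finset (Finset α)} (hE : ∀ e ∈ E, e.card = 1)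
    {x : α → ℝ} (hx : x ∈ weightings Set.univ) (h : 1 ≤ weight E x) {i : α} (hi : 0 < x i) :
    {i} ∈ E := by
  classical
  by_contra hiE
  have h1 := weight_mono hx.1.1 (show E ⊆ powersetCard 1 (univ.erase i) from fun e he => by
    refine mem_powersetCard.2 ⟨subset_erase.2 ⟨subset_univ _, fun hie => hiE ?_⟩, hE e he⟩
    obtain ⟨j, rfl⟩ := card_eq_one.1 (hE e he)
    rwa [mem_singleton.1 hie])
  rw [weight_powersetCard_one] at h1
  have h2 := add_sum_erase univ x (mem_univ i)
  rw [hx.1.2] at h2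
  linarith

/-- A `{1,3}`-graph in the given range whose graph-Lagrangian is at least that of the complete
one has a complete subgraph of order `t`, namely the support of an optimal weighting. -/
lemma hasMaxCompleteOrder_of_le_lagrangian {H : Hypergraph α} {t : ℕ} (ht : 3 ≤ t)
    (hT : H.edgeTypes = {1, 3})
    (hcard : ((edgesOfCard H 3).card : ℝ) ≤ t.choose 3 + (t - 1).choose 2 - (t : ℝ) / 2)
    (hle : (Hypergraph.completeTypes {1, 3} t).lagrangian ≤ H.lagrangian) :
    H.HasMaxCompleteOrder {1, 3} t := by
  classical
  have ht0 : (t : ℝ) ≠ 0 := by exact_mod_cast (by omega : t ≠ 0)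
  obtain ⟨e, he⟩ := exists_mem_edgesOfCard (H := H) (r := 3) (by simp [hT])
  obtain ⟨heH, he3⟩ := mem_edgesOfCard.1 he
  obtain ⟨v, hv⟩ : e.Nonempty := card_pos.1 (by omega)
  obtain ⟨x, hx, hxH⟩ := (H.isGreatest_lagrangian
    ⟨v, H.subset_vertexSet_of_mem_edgeSet heH (mem_coe.2 hv)⟩).1
  have hcoe : ((({1, 3} : Finset ℕ)) : Set ℕ) = {1, 3} := by simp
  have hT' : H.edgeTypes = (({1, 3} : Finset ℕ) : Set ℕ) := by rw [hT, hcoe]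
  have hxu := mem_weightings_univ hx
  rw [← hcoe, lagrangian_completeTypes (by simp) (by simp; omega) (by omega), ← hxH,
    lagrangianPoly_eq_sum hT', sum_pair (by omega), sum_pair (by omega), Nat.choose_one_right,
    pow_one, mul_one_div_cancel ht0, Nat.factorial_one, Nat.cast_one, one_mul, one_mul] at hle
  have h1 := weight_le_one_of_card_eq_one (E := edgesOfCard H 1) card_eq_of_mem_edgesOfCard hxu
  have h6 : (((3 : ℕ).factorial : ℕ) : ℝ) = 6 := by norm_num [Nat.factorial]
  rw [h6] at hle
  obtain ⟨hW, hWE, hW3⟩ := complete_of_choose_three_le card_eq_of_mem_edgesOfCard ht hcard hxu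
    (by linarith)
  refine hasMaxCompleteOrder_of_three_mem ht hcard (by simp) ⟨fun i hi => ?_, ?_, ?_⟩ hW
  · by_contra hiH
    have h0 := (mem_filter.1 (mem_coe.1 hi)).2
    rw [hx.2 i hiH] at h0
    exact lt_irrefl _ h0
  · rw [hW]
    rintro k (rfl | rfl) <;> omega
  · rintro d hd (hd1 | hd3)
    · obtain ⟨i, rfl⟩ := card_eq_one.1 hd1
      exact (mem_edgesOfCard.1 (singleton_mem_of_one_le_weight card_eq_of_mem_edgesOfCard hxu
        (by linarith) (mem_filter.1 (singleton_subset_iff.1 hd)).2)).1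
    · exact (mem_edgesOfCard.1 (hWE (mem_powersetCard.2 ⟨hd, hd3⟩))).1

lemma lagrangian_eq_of_one_three {H : Hypergraph α} {t : ℕ} (ht : 3 ≤ t)
    (hT : H.edgeTypes = {1, 3}) (hcard : (edgesOfCard H 3).card ≤ t.choose 3 + (t - 1).choose 2)
    (hmax : H.HasMaxCompleteOrder {1, 3} t) :
    H.lagrangian = (Hypergraph.completeTypes {1, 3} t).lagrangian := by
  classical
  obtain ⟨S, hS, hSt⟩ := hmax.1
  have ht0 : (t : ℝ) ≠ 0 := by exact_mod_cast (by omega : t ≠ 0)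
  have hcoe : ((({1, 3} : Finset ℕ)) : Set ℕ) = {1, 3} := by simp
  rw [← hcoe] at hT hS ⊢
  refine lagrangian_eq_completeTypes hT (by simp) hS hSt (by omega) fun x hx => ?_
  rw [sum_pair (by omega), sum_pair (by omega), Nat.choose_one_right, pow_one,
    mul_one_div_cancel ht0]
  refine add_le_add (mul_le_mul_of_nonneg_left ?_ (by positivity))
    (mul_le_mul_of_nonneg_left ?_ (by positivity))
  · exact weight_le_one_of_card_eq_one card_eq_of_mem_edgesOfCard (mem_weightings_univ hx)
  · exact weight_edgesOfCard_three_le (by simp) hmax (ncard_level_edgeSet H 3) hcard hx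

end Hypergraph

end GraphLagrangian

theorem theorem3p4 {α : Type*} [Fintype α] (H : Hypergraph α) (m t : ℕ) :
    -- the claim for `{2,r}`-graphs and for `{1,2,r}`-graphs
    (∀ r : ℕ, 3 ≤ r →
      (t.choose r : ℤ) ≤ m →
      (m : ℤ) ≤ t.choose r + (t - 1).choose (r - 1)
        - (2 ^ (r - 3) - 1) * ((t - 1).choose (r - 2) - 1) →
      H.vertexSet.ncard = t + 1 →
      (H.level r).edgeSet.ncard = m →
      (H.edgeTypes = {2, r} →
        H.HasMaxCompleteOrder {2, r} t → H.HasMaxCompleteOrder {2} t →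
        H.lagrangian = (Hypergraph.completeTypes {2, r} t).lagrangian) ∧
      (H.edgeTypes = {1, 2, r} →
        H.HasMaxCompleteOrder {1, 2, r} t → H.HasMaxCompleteOrder {1, 2} t →
        H.lagrangian = (Hypergraph.completeTypes {1, 2, r} t).lagrangian)) ∧
    -- the claim for `{2,3}`-graphs and for `{1,2,3}`-graphs
    (t.choose 3 ≤ m →
      m ≤ t.choose 3 + (t - 1).choose 2 →
      (H.level 3).edgeSet.ncard = m →
      (H.edgeTypes = {2, 3} →
        H.HasMaxCompleteOrder {2, 3} t → H.HasMaxCompleteOrder {2} t →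
        H.lagrangian = (Hypergraph.completeTypes {2, 3} t).lagrangian) ∧
      (H.edgeTypes = {1, 2, 3} →
        H.HasMaxCompleteOrder {1, 2, 3} t → H.HasMaxCompleteOrder {1, 2} t →
        H.lagrangian = (Hypergraph.completeTypes {1, 2, 3} t).lagrangian)) ∧
    -- the claim for `{1,3}`-graphs
    (t.choose 3 ≤ m →
      (m : ℝ) ≤ t.choose 3 + (t - 1).choose 2 - (t : ℝ) / 2 →
      (H.level 3).edgeSet.ncard = m →
      H.edgeTypes = {1, 3} →
      (H.HasMaxCompleteOrder {1, 3} t →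
        H.lagrangian = (Hypergraph.completeTypes {1, 3} t).lagrangian) ∧
      (¬ H.HasMaxCompleteOrder {1, 3} t →
        H.lagrangian < (Hypergraph.completeTypes {1, 3} t).lagrangian) ∧
      (¬ H.HasMaxCompleteOrder {3} t →
        H.lagrangian < (Hypergraph.completeTypes {1, 3} t).lagrangian)) := by
  refine ⟨fun r hr _ hle hV hm => ⟨fun hT hmax hmax₂ => ?_, fun hT hmax hmax₂ => ?_⟩,
    fun _ hle hm => ⟨fun hT hmax hmax₂ => ?_, fun hT hmax hmax₂ => ?_⟩,
    fun _ hle hm hT => ?_⟩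
  · exact GraphLagrangian.lagrangian_eq_of_two hr hT hmax hmax₂ fun x hx =>
      GraphLagrangian.weight_edgesOfCard_le hr (by simp) hV hmax hm hle hx
  · exact GraphLagrangian.lagrangian_eq_of_one_two hr hT hmax hmax₂ fun x hx =>
      GraphLagrangian.weight_edgesOfCard_le hr (by simp) hV hmax hm hle hx
  · exact GraphLagrangian.lagrangian_eq_of_two le_rfl hT hmax hmax₂ fun x hx =>
      GraphLagrangian.weight_edgesOfCard_three_le (by simp) hmax hm hle hx
  · exact GraphLagrangian.lagrangian_eq_of_one_two le_rfl hT hmax hmax₂ fun x hx =>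
      GraphLagrangian.weight_edgesOfCard_three_le (by simp) hmax hm hle hx
  · rw [GraphLagrangian.ncard_level_edgeSet] at hm
    obtain ⟨e, he⟩ := GraphLagrangian.exists_mem_edgesOfCard (H := H) (r := 3) (by simp [hT])
    have hpos := Finset.card_pos.2 ⟨e, he⟩
    rw [hm] at hpos
    have hm1 : (1 : ℝ) ≤ m := by exact_mod_cast hpos
    -- An edge of size three exists, which the bound on `m` excludes for `t ≤ 2`.
    have ht : 3 ≤ t := by
      by_contra! hlt
      interval_cases t <;> norm_num [Nat.choose] at hle <;> linarith
    rw [← hm] at hle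
    have hstrict : ¬ H.HasMaxCompleteOrder {1, 3} t →
        H.lagrangian < (Hypergraph.completeTypes {1, 3} t).lagrangian := fun hmax => by
      by_contra! hge
      exact hmax (GraphLagrangian.hasMaxCompleteOrder_of_le_lagrangian ht hT hle hge)
    refine ⟨fun hmax => GraphLagrangian.lagrangian_eq_of_one_three ht hT ?_ hmax, hstrict,
      fun hmax => hstrict fun hmax₁ => hmax ?_⟩
    · have h0 : (0 : ℝ) ≤ (t : ℝ) / 2 := by positivity
      have h1 : ((GraphLagrangian.edgesOfCard H 3).card : ℝ) ≤ t.choose 3 + (t - 1).choose 2 := by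
        linarith
      exact_mod_cast h1
    · obtain ⟨S, hS, hSt⟩ := hmax₁.1
      refine GraphLagrangian.hasMaxCompleteOrder_of_three_mem ht hle rfl
        ⟨hS.1, fun k hk => hS.2.1 k (Or.inr hk), fun e he hc => hS.2.2 e he (Or.inr hc)⟩ hSt
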